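/- **Setting.** Let $\hbar,c,m,e>0$ and $q\neq0$ be real constants, $\iota=q/|q|$, $Z=|q|/e$, $\Phi_0=2\pi\hbar c/e$. Let $\Gamma=\mathbb Za+\mathbb Zb\subset\mathbb R^2$ be a lattice with $\Omega=a_1b_2-a_2b_1>0$, dual vectors $a^*=\Omega^{-1}(b_2,-b_1)$, $b^*=\Omega^{-1}(-a_2,a_1)$, and $E_0=\hbar^2/(m\Omega)$. Let $V_\Gamma:\mathbb R^2\to\mathbb R$ and $A_\Gamma:\mathbb R^2\to\mathbb R^2$ be $\Gamma$-periodic, and suppose that Assumption $(A_s)$ holds: $V_\Gamma$ and both components of $A_\Gamma$ are in $C^\infty_b(\mathbb R^2,\mathbb R)$. The gauge is $\nabla\cdot A_\Gamma=0$. Put $\natural=0$ if $A_\Gamma\neq0$ and $\natural=1$ if $A_\Gamma=0$. Let $v_{n,m}$, $f^{(1)}_{n,m}$, $f^{(2)}_{n,m}$ be the Fourier coefficients (with respect to $e^{2\pi i(n\,a^*\cdot r+m\,b^*\cdot r)}$, $n,m\in\mathbb Z$) of $$\tfrac1{E_0}\Big(V_\Gamma+\tfrac{q^2}{2mc^2}|A_\Gamma|^2\Big),\qquad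 2\pi\tfrac{Z\Omega}{\Phi_0}\,a^*\cdot A_\Gamma,\qquad 2\pi\tfrac{Z\Omega}{\Phi_0}\,b^*\cdot A_\Gamma .$$ On $\mathcal H_f=L^2(\mathbb R,dx)$ let $Q$ be multiplication by $x$, $P=-i\iota\,\frac{d}{dx}$, and let $$\Xi=\tfrac1{2\Omega}\big(|a|^2P^2+|b|^2Q^2-a\cdot b\,(QP+PQ)\big),\qquad I_{n,m}=nP-mQ .$$ Put $z_a=(a_1-ia_2)/\sqrt\Omega$, $z_b=(b_1-ib_2)/\sqrt\Omega$, $\mathfrak a=\frac{i}{\sqrt2}(\overline{z_a}P-\overline{z_b}Q)$ and $\mathfrak a^\dagger=\frac{-i}{\sqrt2}(z_aP-z_bQ)$, so that $[\mathfrak a,\mathfrak a^\dagger]=\iota$. The generalized Hermite functions are $\psi_k=(k!)^{-1/2}(\mathfrak c)^k\psi_0$, $k\ge0$, where $\mathfrak c=\mathfrak a^\dagger$ if $\iota=1$, $\mathfrak c=\mathfrak a$ if $\iota=-1$, and $\psi_0(x)=(2\beta/\pi)^{1/4}e^{-(\beta-i\iota\alpha)x^2}$ with $\alpha=\frac{a\cdot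 b}{2|a|^2}$, $\beta=\frac{\Omega}{2|a|^2}$. Let $\mathcal L$ be their linear span. The operators $\Xi$, $Q$, $P$, $I_{n,m}^j$, $I_{n,m}^j(f^{(1)}_{n,m}Q+f^{(2)}_{n,m}P)$ are understood as the closures in $\mathcal H_f$ of their restrictions to $\mathcal L$; $\mathcal F$ is the domain of $\Xi$, with the norm $\|\psi\|_{\mathcal F}=\|\Xi\psi\|$. For $\delta>0$ and $(p,x)\in\mathbb R^2$ put $H_\delta(p,x)=\Xi+\delta W_\delta(p,x)+\delta^2V_\delta(p,x)$ with $$V_\delta(p,x)=\sum_{n,m}v_{n,m}e^{2\pi i(np+mx)}e^{2\pi i\delta I_{n,m}},\qquad W_\delta(p,x)=\sum_{n,m}e^{2\pi i(np+mx)}e^{2\pi i\delta I_{n,m}}\big(f^{(1)}_{n,m}Q+f^{(2)}_{n,m}P\big),$$ and let $\widetilde H^\natural_\delta(p,x)=\Xi+\sum_{j=1}^{2(1+\natural)}\delta^j(W_j+V_j)(p,x)$ be its truncated expansion, where $V_1=0$ and, for $j\ge0$, $$V_{j+2}=\tfrac{(2\pi i)^j}{j!}\sum_{n,m}e^{2\pi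 i(np+mx)}v_{n,m}I_{n,m}^j,\qquad W_{j+1}=\tfrac{(2\pi i)^j}{j!}\sum_{n,m}e^{2\pi i(np+mx)}I_{n,m}^j\big(f^{(1)}_{n,m}Q+f^{(2)}_{n,m}P\big).$$ Let $R^\natural_\delta=H_\delta-\widetilde H^\natural_\delta$ be the remainder symbol. **Proposition 4.5.** 1. There is a constant $C$ such that for all $\delta>0$ and all $(p,x)\in\mathbb R^2$ the operator $R^\natural_\delta(p,x)$ is defined on all of $\mathcal F$ and $$\|R^\natural_\delta(p,x)\|_{\mathcal B(\mathcal F,\mathcal H_f)}\le C\,\delta^{2(\natural+1)} .$$ 2. For every finite set $s\subset\mathbb N$, with $\pi_r=\sum_{k\in s}|\psi_k\rangle\langle\psi_k|$, there is a constant $C$ such that for all $\delta>0$ and all $(p,x)\in\mathbb R^2$ the operator $R^\natural_\delta(p,x)\pi_r$ is bounded on $\mathcal H_f$, the operator $\pi_rR^\natural_\delta(p,x)$ (defined on $\mathcal F$) extends to a bounded operator on $\mathcal H_f$, and $$\|R^\natural_\delta(p,x)\,\pi_r\|_{\mathcal B(\mathcal H_f)}=\|\pi_r\,R^\natural_\delta(p,x)\|_{\mathcal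 B(\mathcal H_f)}\le C\,\delta^{2(\natural+1)+1},\qquad \|[R^\natural_\delta(p,x);\pi_r]\|_{\mathcal B(\mathcal H_f)}\le C\,\delta^{2(\natural+1)+1}.$$ -/

import Mathlib

open MeasureTheory
open scoped ContDiff

noncomputable section

/-- The plane `ℝ²` with its Euclidean structure. -/
abbrev Plane : Type := EuclideanSpace ℝ (Fin 2)

/-- The Hilbert space `H_f = L²(ℝ, dx_f)` of the fast degrees of freedom. -/
abbrev Hf : Type := Lp ℂ 2 (volume : Measure ℝ)

/-- Schwartz functions of the fast variable. -/
abbrev Sch : Type := SchwartzMap ℝ ℂ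

/-- The inclusion of the Schwartz space in `L²(ℝ)`. -/
def schIncl : Sch →L[ℂ] Hf := SchwartzMap.toLpCLM ℂ ℂ 2 volume

/-! ### Complex Gaussians are Schwartz functions -/

theorem gauss_bound (c : ℝ) (hc : 0 < c) (n : ℕ) :
    ∃ C : ℝ, ∀ x : ℝ, |x| ^ n * Real.exp (-(c * x ^ 2)) ≤ C := by
  refine ⟨1 + (n.factorial : ℝ) / c ^ n, fun x => ?_⟩
  have h1 : |x| ^ n ≤ 1 + |x| ^ (2 * n) := by
    rcases le_total |x| 1 with h | h
    · have := pow_le_one₀ (n := n) (abs_nonneg x) h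
      have h2 : 0 ≤ |x| ^ (2 * n) := by positivity
      linarith
    · have := pow_le_pow_right₀ h (show n ≤ 2 * n by omega)
      linarith
  have h2 : (c * x ^ 2) ^ n ≤ n.factorial * Real.exp (c * x ^ 2) := by
    have := Real.pow_div_factorial_le_exp (x := c * x ^ 2) (by positivity) n
    rw [div_le_iff₀ (by positivity)] at this
    linarith
  have hexp : Real.exp (c * x ^ 2) * Real.exp (-(c * x ^ 2)) = 1 := by
    rw [← Real.exp_add]; simp
  have h3 : |x| ^ (2 * n) * Real.exp (-(c * x ^ 2)) ≤ n.factorial / c ^ n := by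
    rw [le_div_iff₀ (by positivity)]
    have h4 : |x| ^ (2 * n) * Real.exp (-(c * x ^ 2)) * c ^ n
        = (c * x ^ 2) ^ n * Real.exp (-(c * x ^ 2)) := by
      rw [mul_pow, pow_mul, sq_abs]; ring
    rw [h4]
    calc _ ≤ (n.factorial * Real.exp (c * x ^ 2)) * Real.exp (-(c * x ^ 2)) :=
          mul_le_mul_of_nonneg_right h2 (Real.exp_pos _).le
      _ = n.factorial := by rw [mul_assoc, hexp, mul_one]
  have h5 : Real.exp (-(c * x ^ 2)) ≤ 1 := Real.exp_le_one_iff.2 (by nlinarith [sq_nonneg x])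
  calc |x| ^ n * Real.exp (-(c * x ^ 2))
      ≤ (1 + |x| ^ (2 * n)) * Real.exp (-(c * x ^ 2)) :=
        mul_le_mul_of_nonneg_right h1 (Real.exp_pos _).le
    _ ≤ _ := by rw [add_mul, one_mul]; linarith

theorem gauss_poly_bound (w : ℂ) (hw : 0 < w.re) (P : Polynomial ℂ) :
    ∃ C : ℝ, ∀ x : ℝ, ‖P.eval (x : ℂ) * Complex.exp (-w * (x : ℂ) ^ 2)‖ ≤ C := by
  have hre : ∀ x : ℝ, ‖Complex.exp (-w * (x : ℂ) ^ 2)‖ = Real.exp (-(w.re * x ^ 2)) := by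
    intro x
    rw [Complex.norm_exp]
    congr 1
    rw [← Complex.ofReal_pow, Complex.re_mul_ofReal, Complex.neg_re]
    ring
  induction P using Polynomial.induction_on' with
  | add p q hp hq =>
    obtain ⟨C, hC⟩ := hp
    obtain ⟨D, hD⟩ := hq
    refine ⟨C + D, fun x => ?_⟩
    rw [Polynomial.eval_add, add_mul]
    exact (norm_add_le _ _).trans (add_le_add (hC x) (hD x))
  | monomial n a =>
    obtain ⟨C, hC⟩ := gauss_bound w.re hw n
    refine ⟨‖a‖ * C, fun x => ?_⟩
    rw [norm_mul, hre, Polynomial.eval_monomial, norm_mul, norm_pow, Complex.norm_real,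
      Real.norm_eq_abs, mul_assoc]
    exact mul_le_mul_of_nonneg_left (hC x) (norm_nonneg a)

theorem gauss_iteratedDeriv (w : ℂ) (n : ℕ) : ∃ P : Polynomial ℂ,
    iteratedDeriv n (fun x : ℝ => Complex.exp (-w * (x : ℂ) ^ 2))
      = fun x : ℝ => P.eval (x : ℂ) * Complex.exp (-w * (x : ℂ) ^ 2) := by
  induction n with
  | zero => exact ⟨1, by simp⟩
  | succ n ih =>
    obtain ⟨P, hP⟩ := ih
    refine ⟨P.derivative + P * (Polynomial.C (-w) * (2 * Polynomial.X)), ?_⟩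
    rw [iteratedDeriv_succ, hP]
    funext x
    have h1 : HasDerivAt (fun x : ℝ => P.eval (x : ℂ)) (P.derivative.eval (x : ℂ)) x :=
      (P.hasDerivAt (x : ℂ)).comp_ofReal
    have h2 : HasDerivAt (fun z : ℂ => Complex.exp (-w * z ^ 2))
        (Complex.exp (-w * (x : ℂ) ^ 2) * (-w * (2 * (x : ℂ)))) (x : ℂ) := by
      have := ((hasDerivAt_pow 2 (x : ℂ)).const_mul (-w)).cexp
      simpa using this
    have h3 := h1.mul h2.comp_ofReal
    refine h3.deriv.trans ?_
    simp
    ring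

/-- The Gaussian `x ↦ exp (-w x²)`, `Re w > 0`, as a Schwartz function. -/
def gaussSch (w : ℂ) (hw : 0 < w.re) : Sch where
  toFun x := Complex.exp (-w * (x : ℂ) ^ 2)
  smooth' := by
    have : ContDiff ℝ ∞ (fun x : ℝ => (x : ℂ)) := Complex.ofRealCLM.contDiff
    exact (contDiff_const.mul (this.pow 2)).cexp
  decay' := by
    intro k n
    obtain ⟨P, hP⟩ := gauss_iteratedDeriv w n
    obtain ⟨C, hC⟩ := gauss_poly_bound w hw (Polynomial.X ^ k * P)
    refine ⟨C, fun x => ?_⟩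
    rw [norm_iteratedFDeriv_eq_norm_iteratedDeriv, hP]
    have := hC x
    rw [Polynomial.eval_mul, Polynomial.eval_pow, Polynomial.eval_X, mul_assoc, norm_mul,
      norm_pow, Complex.norm_real] at this
    exact this

/-! ### Unbounded operators -/

/-- The sum of a series of unbounded operators: its domain consists of the vectors that lie in
the domain of every term and for which the series converges in `H_f`. -/
def opSeries {ι : Type} (T : ι → (Hf →ₗ.[ℂ] Hf)) : Hf →ₗ.[ℂ] Hf where
  domain :=
    { carrier := {ψ | ∃ h : ∀ i, ψ ∈ (T i).domain, Summable fun i => T i ⟨ψ, h i⟩}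
      zero_mem' := ⟨fun i => (T i).domain.zero_mem, by
        have : (fun i => T i ⟨0, (T i).domain.zero_mem⟩) = fun _ => 0 :=
          funext fun i => (T i).map_zero
        rw [this]; exact summable_zero⟩
      add_mem' := by
        rintro x y ⟨hx, sx⟩ ⟨hy, sy⟩
        refine ⟨fun i => (T i).domain.add_mem (hx i) (hy i), ?_⟩
        have : (fun i => T i ⟨x + y, (T i).domain.add_mem (hx i) (hy i)⟩)
            = fun i => T i ⟨x, hx i⟩ + T i ⟨y, hy i⟩ :=
          funext fun i => (T i).map_add ⟨x, hx i⟩ ⟨y, hy i⟩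
        rw [this]; exact sx.add sy
      smul_mem' := by
        rintro c x ⟨hx, sx⟩
        refine ⟨fun i => (T i).domain.smul_mem c (hx i), ?_⟩
        have : (fun i => T i ⟨c • x, (T i).domain.smul_mem c (hx i)⟩)
            = fun i => c • T i ⟨x, hx i⟩ :=
          funext fun i => (T i).map_smul c ⟨x, hx i⟩
        rw [this]; exact sx.const_smul c }
  toFun :=
    { toFun := fun ψ => ∑' i, T i ⟨ψ.1, ψ.2.1 i⟩
      map_add' := by
        rintro ⟨x, hx, sx⟩ ⟨y, hy, sy⟩
        rw [← sx.tsum_add sy]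
        exact tsum_congr fun i => (T i).map_add ⟨x, hx i⟩ ⟨y, hy i⟩
      map_smul' := by
        rintro c ⟨x, hx, sx⟩
        rw [RingHom.id_apply, ← sx.tsum_const_smul c]
        exact tsum_congr fun i => (T i).map_smul c ⟨x, hx i⟩ }

/-- Multiplication by the phase `x ↦ exp (i v x)`, an isometry of `H_f`. -/
def phaseMul (v : ℝ) : Hf →ₗᵢ[ℂ] Hf where
  toFun ψ := MemLp.toLp (fun x : ℝ => Complex.exp (Complex.I * (v * x : ℝ)) * ψ x)
    ((Lp.memLp ψ).of_le (by
        have := Lp.aestronglyMeasurable ψ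
        have h : Continuous fun x : ℝ => Complex.exp (Complex.I * (v * x : ℝ)) := by fun_prop
        exact h.aestronglyMeasurable.mul this)
      (Filter.Eventually.of_forall fun x => by
        rw [norm_mul, mul_comm Complex.I, Complex.norm_exp_ofReal_mul_I, one_mul]))
  map_add' f g := by
    rw [← MemLp.toLp_add]
    apply MemLp.toLp_congr
    filter_upwards [Lp.coeFn_add f g] with x hx
    rw [hx]
    simp only [Pi.add_apply, mul_add]
  map_smul' c f := by
    rw [RingHom.id_apply, ← MemLp.toLp_const_smul]
    apply MemLp.toLp_congr
    filter_upwards [Lp.coeFn_smul c f] with x hx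
    simp only [hx, Pi.smul_apply, smul_eq_mul]
    ring
  norm_map' f := by
    simp only [LinearMap.coe_mk, AddHom.coe_mk]
    rw [Lp.norm_toLp, Lp.norm_def]
    congr 1
    apply eLpNorm_congr_norm_ae
    refine Filter.Eventually.of_forall fun x => ?_
    rw [norm_mul, mul_comm Complex.I, Complex.norm_exp_ofReal_mul_I, one_mul]

/-- The translation `ψ ↦ ψ (· + t)`, an isometry of `H_f`. -/
def shift (t : ℝ) : Hf →ₗᵢ[ℂ] Hf :=
  Lp.compMeasurePreservingₗᵢ ℂ (fun x : ℝ => x + t) (measurePreserving_add_right volume t)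

/-- The Weyl operator `exp (i (u P + v Q))` in the Schrödinger representation
`Q = x`, `P = -i ι d/dx` (`ι = ± 1`, so that `[Q, P] = i ι`): the unitary
`(exp (i (u P + v Q)) ψ)(x) = exp (i ι u v / 2) exp (i v x) ψ(x + ι u)`. -/
def weyl (ι u v : ℝ) : Hf →L[ℂ] Hf :=
  Complex.exp (Complex.I * (ι * u * v / 2 : ℝ)) •
    ((phaseMul v).toContinuousLinearMap ∘L (shift (ι * u)).toContinuousLinearMap)

/-! ### The model -/

/-- The data of the Bloch-Landau model without external potentials other than the uniform
magnetic field: positive physical constants (reduced Planck constant `hbar`, speed of light `c`,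
mass `m`, elementary charge `e`), a charge `q ≠ 0`, an oriented lattice `Γ = ℤ a + ℤ b`, and
`Γ`-periodic internal potentials `V_Γ` and `A_Γ`. -/
structure BlochLandau where
  hbar : ℝ
  c : ℝ
  m : ℝ
  e : ℝ
  q : ℝ
  hbar_pos : 0 < hbar
  c_pos : 0 < c
  m_pos : 0 < m
  e_pos : 0 < e
  q_ne : q ≠ 0
  a : Plane
  b : Plane
  area_pos : 0 < a 0 * b 1 - a 1 * b 0
  VΓ : Plane → ℝ
  AΓ : Plane → Plane
  V_per : ∀ r, VΓ (r + a) = VΓ r ∧ VΓ (r + b) = VΓ r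
  A_per : ∀ r, AΓ (r + a) = AΓ r ∧ AΓ (r + b) = AΓ r

/-- `f` is smooth, and it and all its derivatives are bounded. -/
def IsCbInfty {E : Type} [NormedAddCommGroup E] [NormedSpace ℝ E] (f : Plane → E) : Prop :=
  ContDiff ℝ ∞ f ∧ ∀ k : ℕ, ∃ C : ℝ, ∀ r, ‖iteratedFDeriv ℝ k f r‖ ≤ C

namespace BlochLandau

variable (M : BlochLandau)

/-- The strong assumption on the internal potentials: `V_Γ` and the two components of `A_Γ` are
of class `C_b^∞(ℝ², ℝ)`. -/
def AssumptionAs : Prop :=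
  IsCbInfty M.VΓ ∧ ∀ j : Fin 2, IsCbInfty fun r => M.AΓ r j

/-- The gauge condition `∇ · A_Γ = 0`. -/
def DivFree : Prop :=
  ∀ r, ∑ j : Fin 2, fderiv ℝ (fun r => M.AΓ r j) r (EuclideanSpace.single j 1) = 0

/-- The area `Ω_Γ = a₁ b₂ - a₂ b₁` of the fundamental cell. -/
def area : ℝ := M.a 0 * M.b 1 - M.a 1 * M.b 0

/-- The sign `ι_q = ± 1` of the charge. -/
def sgn : ℝ := if 0 < M.q then 1 else -1

/-- The dual vector `a^* = Ω_Γ⁻¹ (b₂, -b₁)`. -/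
def aStar : Plane := !₂[M.b 1 / M.area, -M.b 0 / M.area]

/-- The dual vector `b^* = Ω_Γ⁻¹ (-a₂, a₁)`. -/
def bStar : Plane := !₂[-M.a 1 / M.area, M.a 0 / M.area]

/-- The natural unit of energy `E₀ = ℏ² / (m Ω_Γ)`. -/
def energyUnit : ℝ := M.hbar ^ 2 / (M.m * M.area)

/-- The flux quantum `Φ₀ = h c / e`, with `h = 2 π ℏ`. -/
def fluxQuantum : ℝ := 2 * Real.pi * M.hbar * M.c / M.e

/-- The charge number `Z = |q| / e`. -/
def chargeNumber : ℝ := |M.q| / M.e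

/-- The dimensionless scalar potential
`E₀⁻¹ (V_Γ + q² / (2 m c²) |A_Γ|²)` as a `Γ`-periodic function of `r`. -/
def potV (r : Plane) : ℝ :=
  (M.VΓ r + M.q ^ 2 / (2 * M.m * M.c ^ 2) * ‖M.AΓ r‖ ^ 2) / M.energyUnit

/-- `f₁(a^*·r, b^*·r) = 2 π (Z Ω_Γ / Φ₀) (a^* · A_Γ)(r)`. -/
def potF₁ (r : Plane) : ℝ :=
  2 * Real.pi * (M.chargeNumber * M.area / M.fluxQuantum) * inner ℝ M.aStar (M.AΓ r)

/-- `f₂(a^*·r, b^*·r) = 2 π (Z Ω_Γ / Φ₀) (b^* · A_Γ)(r)`. -/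
def potF₂ (r : Plane) : ℝ :=
  2 * Real.pi * (M.chargeNumber * M.area / M.fluxQuantum) * inner ℝ M.bStar (M.AΓ r)

/-- The Fourier coefficient `F_{n,m}` of a `Γ`-periodic function
`F(r) = ∑ F_{n,m} exp (2 π i (n a^*·r + m b^*·r))`; the point `r = x₁ a + x₂ b` has
`a^*·r = x₁` and `b^*·r = x₂`. -/
def fourierCoef (F : Plane → ℝ) (n : ℤ × ℤ) : ℂ :=
  ∫ x₁ in (0 : ℝ)..1, ∫ x₂ in (0 : ℝ)..1,
    Complex.exp (-(2 * Real.pi * Complex.I * (n.1 * x₁ + n.2 * x₂))) *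
      (F (x₁ • M.a + x₂ • M.b) : ℂ)

/-- The indicator `♮` of the periodic vector potential: `0` if `A_Γ ≠ 0`, and `1` if
`A_Γ = 0`. -/
def nat : ℕ := open Classical in if M.AΓ = 0 then 1 else 0

/-! ### Fast operators on Schwartz functions -/

/-- `Q_f`, multiplication by `x`, on Schwartz functions. -/
def Q : Sch →L[ℂ] Sch := SchwartzMap.smulLeftCLM ℂ fun x : ℝ => (x : ℂ)

/-- `P_f = -i ι_q d/dx` on Schwartz functions. -/
def P : Sch →L[ℂ] Sch := (-(Complex.I * M.sgn)) • SchwartzMap.derivCLM ℂ ℂ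

/-- `Ξ = (2 Ω_Γ)⁻¹ (|a|² P_f² + |b|² Q_f² - a·b (Q_f P_f + P_f Q_f))` on Schwartz functions. -/
def xiSch : Sch →L[ℂ] Sch :=
  ((1 / (2 * M.area) : ℝ) : ℂ) •
    (((‖M.a‖ ^ 2 : ℝ) : ℂ) • (M.P ∘L M.P) + ((‖M.b‖ ^ 2 : ℝ) : ℂ) • (Q ∘L Q)
      - ((inner ℝ M.a M.b : ℝ) : ℂ) • (Q ∘L M.P + M.P ∘L Q))

/-- `I_{n,m} = n P_f - m Q_f` on Schwartz functions. -/
def iSch (n : ℤ × ℤ) : Sch →L[ℂ] Sch := (n.1 : ℂ) • M.P - (n.2 : ℂ) • Q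

/-- `z_a = (a₁ - i a₂) / √Ω_Γ`. -/
def za : ℂ := ((M.a 0 : ℂ) - Complex.I * (M.a 1 : ℂ)) / (Real.sqrt M.area : ℂ)

/-- `z_b = (b₁ - i b₂) / √Ω_Γ`. -/
def zb : ℂ := ((M.b 0 : ℂ) - Complex.I * (M.b 1 : ℂ)) / (Real.sqrt M.area : ℂ)

/-- The operator `𝔞 = (i / √2) (conj z_a P_f - conj z_b Q_f)`. -/
def aOp : Sch →L[ℂ] Sch :=
  (Complex.I / (Real.sqrt 2 : ℂ)) •
    ((starRingEnd ℂ M.za) • M.P - (starRingEnd ℂ M.zb) • Q)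

/-- The operator `𝔞† = (-i / √2) (z_a P_f - z_b Q_f)`. -/
def aDag : Sch →L[ℂ] Sch :=
  (-Complex.I / (Real.sqrt 2 : ℂ)) • (M.za • M.P - M.zb • Q)

/-- The creation operator. As `[𝔞, 𝔞†] = ι_q`, it is `𝔞†` for a positive and `𝔞` for a negative
charge. -/
def creation : Sch →L[ℂ] Sch := if 0 < M.q then M.aDag else M.aOp

/-- `α = a·b / (2 |a|²)`. -/
def gaussα : ℝ := inner ℝ M.a M.b / (2 * ‖M.a‖ ^ 2)

/-- `β = Ω_Γ / (2 |a|²)`. -/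
def gaussβ : ℝ := M.area / (2 * ‖M.a‖ ^ 2)

theorem gaussβ_pos : 0 < M.gaussβ := by
  have h : M.a ≠ 0 := by
    intro h
    have := M.area_pos
    simp [h] at this
  have h2 : 0 < ‖M.a‖ := norm_pos_iff.2 h
  have h3 : 0 < M.area := M.area_pos
  unfold gaussβ
  positivity

/-- The normalized ground state `ψ₀(x) = (2 β / π)^{1/4} exp (-(β - i ι_q α) x²)`. -/
def ground : Sch :=
  (((2 * M.gaussβ / Real.pi) ^ (1 / 4 : ℝ) : ℝ) : ℂ) •
    gaussSch (M.gaussβ - Complex.I * (M.sgn * M.gaussα : ℝ)) (by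
      simpa using M.gaussβ_pos)

/-- The generalized Hermite functions: `ψ_k` is `(k!)^{-1/2}` times the `k`-th power of the
creation operator applied to `ψ₀`. -/
def hermite (k : ℕ) : Sch :=
  ((1 / Real.sqrt k.factorial : ℝ) : ℂ) • (M.creation ^ k) M.ground

/-- The space `𝓛` of finite linear combinations of generalized Hermite functions. -/
def hermiteSpan : Submodule ℂ Sch := Submodule.span ℂ (Set.range M.hermite)

/-- The operator `T` of the Schwartz space, as an unbounded operator of `H_f` with the domain
`𝓛`; it is given by its graph. -/
def onHermite (T : Sch →L[ℂ] Sch) : Hf →ₗ.[ℂ] Hf :=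
  (M.hermiteSpan.map
    (schIncl.toLinearMap.prod (schIncl ∘L T).toLinearMap)).toLinearPMap

/-- The closure in `H_f` of the operator `T` on `𝓛`. -/
def closedOp (T : Sch →L[ℂ] Sch) : Hf →ₗ.[ℂ] Hf := (M.onHermite T).closure

/-- The operator `Ξ` with its domain of self-adjointness `F`, the closure of `𝓛` in the graph
norm; `F = M.xi.domain` carries the norm `ψ ↦ ‖Ξ ψ‖`. -/
def xi : Hf →ₗ.[ℂ] Hf := M.closedOp M.xiSch

/-! ### The symbols -/

/-- The phase `exp (2 π i (n p_s + m x_s))`. -/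
def phase (p x : ℝ) (n : ℤ × ℤ) : ℂ :=
  Complex.exp (2 * Real.pi * Complex.I * (n.1 * p + n.2 * x))

/-- The unitary `exp (2 π i δ I_{n,m}) = exp (2 π i δ (n P_f - m Q_f))`. -/
def expI (δ : ℝ) (n : ℤ × ℤ) : Hf →L[ℂ] Hf :=
  weyl M.sgn (2 * Real.pi * δ * n.1) (-(2 * Real.pi * δ * n.2))

/-- `V_δ(p_s, x_s) = ∑ v_{n,m} exp (2 π i (n p_s + m x_s)) exp (2 π i δ I_{n,m})`. -/
def symV (δ p x : ℝ) : Hf →ₗ.[ℂ] Hf :=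
  opSeries fun n : ℤ × ℤ =>
    (M.fourierCoef M.potV n * phase p x n) • (M.expI δ n).toLinearMap.toPMap ⊤

/-- `W_δ(p_s, x_s) = ∑ exp (2 π i (n p_s + m x_s)) exp (2 π i δ I_{n,m})
(f¹_{n,m} Q_f + f²_{n,m} P_f)`. -/
def symW (δ p x : ℝ) : Hf →ₗ.[ℂ] Hf :=
  opSeries fun n : ℤ × ℤ =>
    phase p x n • (M.expI δ n).toLinearMap.compPMap
      (M.fourierCoef M.potF₁ n • M.closedOp Q + M.fourierCoef M.potF₂ n • M.closedOp M.P)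

/-- The symbol `H_δ = Ξ + δ W_δ + δ² V_δ`. -/
def symH (δ p x : ℝ) : Hf →ₗ.[ℂ] Hf :=
  M.xi + (δ : ℂ) • M.symW δ p x + ((δ ^ 2 : ℝ) : ℂ) • M.symV δ p x

/-- `V_{j+2}(p_s, x_s) = (2 π i)^j / j! ∑ exp (2 π i (n p_s + m x_s)) v_{n,m} I_{n,m}^j`, the
coefficient of `δ^j` in the expansion of `V_δ`, and `V_0 = V_1 = 0`. -/
def coefV (p x : ℝ) : ℕ → (Hf →ₗ.[ℂ] Hf)
  | 0 => 0
  | 1 => 0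
  | j + 2 => ((2 * Real.pi * Complex.I) ^ j / (j.factorial : ℂ)) •
      opSeries fun n : ℤ × ℤ =>
        (phase p x n * M.fourierCoef M.potV n) • M.closedOp (M.iSch n ^ j)

/-- `M^j_{n,m} = I_{n,m}^j (f¹_{n,m} Q_f + f²_{n,m} P_f)`. -/
def opM (j : ℕ) (n : ℤ × ℤ) : Hf →ₗ.[ℂ] Hf :=
  M.closedOp ((M.iSch n ^ j) ∘L
    (M.fourierCoef M.potF₁ n • Q + M.fourierCoef M.potF₂ n • M.P))

/-- `W_{j+1}(p_s, x_s) = (2 π i)^j / j! ∑ exp (2 π i (n p_s + m x_s)) M^j_{n,m}`, the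
coefficient of `δ^j` in the expansion of `W_δ`, and `W_0 = 0`. -/
def coefW (p x : ℝ) : ℕ → (Hf →ₗ.[ℂ] Hf)
  | 0 => 0
  | j + 1 => ((2 * Real.pi * Complex.I) ^ j / (j.factorial : ℂ)) •
      opSeries fun n : ℤ × ℤ => phase p x n • M.opM j n

/-- `H_j = W_j + V_j`. -/
def coefH (p x : ℝ) (j : ℕ) : Hf →ₗ.[ℂ] Hf := M.coefW p x j + M.coefV p x j

/-- The approximated symbol `H̃^♮_δ = Ξ + ∑_{j=1}^{2 (1 + ♮)} δ^j H_j`. -/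
def symApprox (δ p x : ℝ) : Hf →ₗ.[ℂ] Hf :=
  M.xi + ∑ j ∈ Finset.Icc 1 (2 * (1 + M.nat)), ((δ ^ j : ℝ) : ℂ) • M.coefH p x j

/-- The remainder symbol `R^♮_δ = H_δ - H̃^♮_δ`. -/
def remainder (δ p x : ℝ) : Hf →ₗ.[ℂ] Hf := M.symH δ p x - M.symApprox δ p x

/-! ### Norms -/

/-- `T` maps all of `F` to `H_f`, with `‖T‖_{B(F, H_f)} ≤ K`, where `‖ψ‖_F = ‖Ξ ψ‖`. -/
def NormFLe (T : Hf →ₗ.[ℂ] Hf) (K : ℝ) : Prop :=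
  ∀ ψ : M.xi.domain, ∃ h : (ψ : Hf) ∈ T.domain, ‖T ⟨ψ, h⟩‖ ≤ K * ‖M.xi ψ‖

/-- The orthogonal projection `π_r = ∑_{k ∈ s} |ψ_k⟩⟨ψ_k|` on the span of finitely many
generalized Hermite functions. -/
def proj (s : Finset ℕ) : Hf →L[ℂ] Hf :=
  ∑ k ∈ s, InnerProductSpace.rankOne ℂ (schIncl (M.hermite k)) (schIncl (M.hermite k))

/-- The bounded operator `S` is `T π_r`, defined on all of `H_f`. -/
def IsRightComp (T : Hf →ₗ.[ℂ] Hf) (s : Finset ℕ) (S : Hf →L[ℂ] Hf) : Prop :=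
  ∀ ψ : Hf, ∃ h : M.proj s ψ ∈ T.domain, S ψ = T ⟨M.proj s ψ, h⟩

/-- The bounded operator `S` extends `π_r T`, defined on the dense subspace `F`. -/
def IsLeftComp (T : Hf →ₗ.[ℂ] Hf) (s : Finset ℕ) (S : Hf →L[ℂ] Hf) : Prop :=
  ∀ ψ : M.xi.domain, ∃ h : (ψ : Hf) ∈ T.domain, S ψ = M.proj s (T ⟨ψ, h⟩)

end BlochLandau

end

noncomputable section

/-! ### Formal adjoints on the Schwartz space -/

/-! Write `J = 2πi I_n` for the generator attached to a Fourier mode `n`. Mode by mode the remainder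
is `δ` times a Taylor remainder of `exp(δJ)` of order `2♮+2` applied to `f¹Q + f²P`, plus `δ²` times
one of order `2♮+1` (`remTerm`). Weak differentiation in `δ` bounds the remainder of order `k` at a
Schwartz function `φ` by `δ^k ‖J^k φ‖` (`norm_taylorRem_le`).

On `F` only products of at most two of `P`, `Q` are controlled by `Ξ`; this follows from `Ξ = 𝔠𝔠* +
1/2`, which makes `‖Ξφ‖²` a sum of nonnegative terms (`exists_xi_bound`). The sharp Taylor bound
needs one factor `I_n` too many, so one order is given up (`norm_taylorRem_succ_le`): what remains
is `I_n(f¹Q + f²P)` and `1` if `♮ = 0`, and `I_n²` if `♮ = 1`, where the vector potential vanishes.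
This yields the power `2(♮+1)`. On a fixed Hermite function every power of `I_n` is available, so
nothing is lost and the exponent gains one. In both cases the sum over modes converges because
Fourier coefficients of smooth periodic functions decay rapidly (`summable_weight_mul_fourierCoef`).

The operators are closures from the Hermite span, so a vector of `F` is approximated in the graph
norm of `Ξ`; the relative bounds make every term converge, which puts the vector in all the domains
and identifies the remainder with a convergent sum of limits of `remTerm`
(`IsApprox.exists_mem_remainder_graph`).

The left composition is treated by duality. The potentials are real and `∇·A_Γ = 0` means `n f¹ + m
f² = 0`, so for `n ≠ 0` the factor `f¹Q + f²P` is a multiple of the generator and commutes with the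
exponential. Hence modes `n` and `-n` are formally adjoint and the remainder is symmetric
(`inner_remainder`). The finite-rank operator `Rπ` therefore has an adjoint extending `πR`, which
gives equal norms and, by the triangle inequality, the commutator bound. -/

theorem inner_schIncl (f g : Sch) :
    inner ℂ (schIncl f) (schIncl g) = ∫ x, starRingEnd ℂ (f x) * g x := by
  have := SchwartzMap.inner_toL2_toL2_eq f g (volume : Measure ℝ)
  rw [show schIncl f = f.toLp 2 volume from rfl, show schIncl g = g.toLp 2 volume from rfl, this]
  refine integral_congr_ae (Filter.Eventually.of_forall fun x => ?_)
  simp [mul_comm]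

theorem integrable_conj_mul (f g : Sch) : Integrable fun x => starRingEnd ℂ (f x) * g x :=
  (SchwartzMap.pairing ((ContinuousLinearMap.mul ℝ ℂ).comp
    (Complex.conjCLE : ℂ →L[ℝ] ℂ)) f g).integrable

theorem denseRange_schIncl : DenseRange schIncl :=
  SchwartzMap.denseRange_toLpCLM (by simp)

/-- Duality on a dense set. It turns scalar estimates for matrix elements into norm estimates, so
that the unitaries need only be differentiated weakly. -/
theorem norm_le_of_forall_inner_schIncl {v : Hf} {K : ℝ} (hK : 0 ≤ K)
    (h : ∀ g : Sch, ‖inner ℂ (schIncl g) v‖ ≤ K * ‖schIncl g‖) : ‖v‖ ≤ K := by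
  have h' : ∀ w : Hf, ‖inner ℂ w v‖ ≤ K * ‖w‖ := by
    intro w
    refine denseRange_schIncl.induction_on (p := fun w => ‖inner ℂ w v‖ ≤ K * ‖w‖) w ?_ h
    exact isClosed_le (by fun_prop) (by fun_prop)
  have h1 := h' v
  rw [inner_self_eq_norm_sq_to_K] at h1
  rcases eq_or_ne v 0 with h0 | h0
  · simpa [h0] using hK
  · have h2 : 0 < ‖v‖ := norm_pos_iff.2 h0
    rw [norm_pow, RCLike.norm_ofReal, abs_norm, sq] at h1
    exact le_of_mul_le_mul_right h1 h2

theorem eq_zero_of_forall_inner_schIncl {v : Hf} (h : ∀ g : Sch, inner ℂ (schIncl g) v = 0) :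
    v = 0 := by
  have := norm_le_of_forall_inner_schIncl (v := v) le_rfl (fun g => by rw [h g]; simp)
  exact norm_le_zero_iff.1 this

/-- `T'` is a formal adjoint of `T`. -/
def IsFormalAdjoint (T T' : Sch →L[ℂ] Sch) : Prop :=
  ∀ φ χ : Sch, inner ℂ (schIncl (T φ)) (schIncl χ) = inner ℂ (schIncl φ) (schIncl (T' χ))

namespace IsFormalAdjoint

variable {T T' S S' : Sch →L[ℂ] Sch}

theorem one : IsFormalAdjoint 1 1 := fun _ _ => rfl

theorem symm (h : IsFormalAdjoint T T') : IsFormalAdjoint T' T := fun φ χ => by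
  rw [← inner_conj_symm, ← h, inner_conj_symm]

theorem add (h : IsFormalAdjoint T T') (h' : IsFormalAdjoint S S') :
    IsFormalAdjoint (T + S) (T' + S') := fun φ χ => by
  simp only [add_apply, map_add, inner_add_left, inner_add_right, h φ χ,
    h' φ χ]

theorem sub (h : IsFormalAdjoint T T') (h' : IsFormalAdjoint S S') :
    IsFormalAdjoint (T - S) (T' - S') := fun φ χ => by
  simp only [sub_apply, map_sub, inner_sub_left, inner_sub_right, h φ χ,
    h' φ χ]

theorem smul (h : IsFormalAdjoint T T') (c : ℂ) :
    IsFormalAdjoint (c • T) (starRingEnd ℂ c • T') := fun φ χ => by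
  simp only [smul_apply, map_smul, inner_smul_left, inner_smul_right, h φ χ]

theorem mul (h : IsFormalAdjoint T T') (h' : IsFormalAdjoint S S') :
    IsFormalAdjoint (T * S) (S' * T') := fun φ χ => by
  simp only [mul_apply_eq_comp, h _ χ, h' φ _]

theorem pow (h : IsFormalAdjoint T T') (j : ℕ) : IsFormalAdjoint (T ^ j) (T' ^ j) := by
  induction j with
  | zero => simpa using one
  | succ j ih => rw [pow_succ, pow_succ']; exact ih.mul h

end IsFormalAdjoint

/-! ### Position, momentum and the generators on Schwartz functions -/

theorem hasTemperateGrowth_ofReal : Function.HasTemperateGrowth (fun x : ℝ => (x : ℂ)) :=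
  Complex.ofRealCLM.hasTemperateGrowth

namespace BlochLandau

variable (M : BlochLandau)

theorem Q_apply (φ : Sch) (x : ℝ) : Q φ x = x * φ x := by
  simp [Q, SchwartzMap.smulLeftCLM_apply_apply hasTemperateGrowth_ofReal]

theorem P_apply (φ : Sch) (x : ℝ) : M.P φ x = -(Complex.I * M.sgn) * deriv φ x := by
  simp [P]

theorem isFormalAdjoint_Q : IsFormalAdjoint Q Q := fun φ χ => by
  rw [inner_schIncl, inner_schIncl]
  refine integral_congr_ae (Filter.Eventually.of_forall fun x => ?_)
  simp only [Q_apply, map_mul, Complex.conj_ofReal]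
  ring

theorem isFormalAdjoint_P : IsFormalAdjoint M.P M.P := fun φ χ => by
  rw [inner_schIncl, inner_schIncl]
  have key := MeasureTheory.integral_bilinear_hasDerivAt_right_eq_neg_left_of_integrable
    (L := ContinuousLinearMap.mul ℝ ℂ) (u := fun x => starRingEnd ℂ (φ x)) (v := fun x => χ x)
    (u' := fun x => starRingEnd ℂ (deriv φ x)) (v' := fun x => deriv χ x)
    (fun x _ => (φ.hasDerivAt x).star) (fun x _ => χ.hasDerivAt x) ?_ ?_ ?_
  · simp only [ContinuousLinearMap.mul_apply'] at key
    have e1 : ∀ x, starRingEnd ℂ (M.P φ x) * χ x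
        = (Complex.I * M.sgn) * (starRingEnd ℂ (deriv φ x) * χ x) := fun x => by
      rw [P_apply]; simp; ring
    have e2 : ∀ x, starRingEnd ℂ (φ x) * M.P χ x
        = -(Complex.I * M.sgn) * (starRingEnd ℂ (φ x) * deriv χ x) := fun x => by
      rw [P_apply]; ring
    simp only [e1, e2, integral_const_mul, key]
    ring
  · exact integrable_conj_mul φ (SchwartzMap.derivCLM ℂ ℂ χ)
  · exact integrable_conj_mul (SchwartzMap.derivCLM ℂ ℂ φ) χ
  · exact integrable_conj_mul φ χ

theorem Q_P_comm (φ : Sch) : Q (M.P φ) - M.P (Q φ) = (Complex.I * M.sgn) • φ := by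
  ext x
  have h : HasDerivAt (fun x : ℝ => (x : ℂ) * φ x) (1 * φ x + x * deriv φ x) x :=
    (HasDerivAt.ofReal_comp (hasDerivAt_id x)).mul (φ.hasDerivAt x)
  have h2 : (Q φ : ℝ → ℂ) = fun x : ℝ => (x : ℂ) * φ x := funext (Q_apply φ)
  simp only [sub_apply, smul_apply, Q_apply, P_apply, h2, h.deriv,
    smul_eq_mul]
  ring

theorem isFormalAdjoint_iSch (n : ℤ × ℤ) : IsFormalAdjoint (M.iSch n) (M.iSch n) := by
  have := (M.isFormalAdjoint_P.smul (n.1 : ℂ)).sub (isFormalAdjoint_Q.smul (n.2 : ℂ))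
  simpa [iSch] using this

/-- The generator `2 π i I_{n,m}` of the one-parameter group `δ ↦ exp (2 π i δ I_{n,m})`. -/
def jSch (n : ℤ × ℤ) : Sch →L[ℂ] Sch := (2 * Real.pi * Complex.I : ℂ) • M.iSch n

theorem iSch_neg (n : ℤ × ℤ) : M.iSch (-n) = -M.iSch n := by
  simp [iSch]; abel

theorem isFormalAdjoint_jSch (n : ℤ × ℤ) : IsFormalAdjoint (M.jSch n) (M.jSch (-n)) := by
  have := (M.isFormalAdjoint_iSch n).smul (2 * Real.pi * Complex.I : ℂ)
  have e : starRingEnd ℂ (2 * Real.pi * Complex.I : ℂ) = -(2 * Real.pi * Complex.I) := by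
    simp [Complex.conj_ofNat]
  rw [e] at this
  simpa [jSch, iSch_neg] using this

theorem jSch_pow (n : ℤ × ℤ) (j : ℕ) :
    M.jSch n ^ j = ((2 * Real.pi * Complex.I : ℂ) ^ j) • M.iSch n ^ j := by
  rw [jSch, smul_pow]

/-! ### The unitaries `exp (2 π i δ I_{n,m})` -/

/-- The pointwise expression of `exp (2 π i δ I_{n,m}) φ`. -/
def expFun (δ : ℝ) (n : ℤ × ℤ) (φ : ℝ → ℂ) (x : ℝ) : ℂ :=
  Complex.exp (Complex.I *
      (M.sgn * (2 * Real.pi * δ * n.1) * (-(2 * Real.pi * δ * n.2)) / 2 : ℝ)) *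
    (Complex.exp (Complex.I * (-(2 * Real.pi * δ * n.2) * x : ℝ)) *
      φ (x + M.sgn * (2 * Real.pi * δ * n.1)))

theorem phaseMul_ae (v : ℝ) (ψ : Hf) : (phaseMul v ψ : ℝ → ℂ) =ᵐ[volume]
    fun x => Complex.exp (Complex.I * (v * x : ℝ)) * ψ x := by
  have h : MemLp (fun x : ℝ => Complex.exp (Complex.I * (v * x : ℝ)) * ψ x) 2 volume := by
    refine (Lp.memLp ψ).of_le ?_ (Filter.Eventually.of_forall fun x => ?_)
    · have h : Continuous fun x : ℝ => Complex.exp (Complex.I * (v * x : ℝ)) := by fun_prop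
      exact h.aestronglyMeasurable.mul (Lp.aestronglyMeasurable ψ)
    · rw [norm_mul, mul_comm Complex.I, Complex.norm_exp_ofReal_mul_I, one_mul]
  exact h.coeFn_toLp

theorem expI_schIncl_ae (δ : ℝ) (n : ℤ × ℤ) (φ : Sch) :
    (M.expI δ n (schIncl φ) : ℝ → ℂ) =ᵐ[volume] M.expFun δ n φ := by
  have h1 := measurePreserving_add_right volume (M.sgn * (2 * Real.pi * δ * n.1))
  have h2 : (shift (M.sgn * (2 * Real.pi * δ * n.1)) (schIncl φ) : ℝ → ℂ) =ᵐ[volume]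
      (schIncl φ : ℝ → ℂ) ∘ fun x => x + M.sgn * (2 * Real.pi * δ * n.1) :=
    Lp.coeFn_compMeasurePreserving _ h1
  have h3 := h1.quasiMeasurePreserving.ae_eq_comp (φ.coeFn_toLp 2 volume)
  have h4 := phaseMul_ae (-(2 * Real.pi * δ * n.2))
    (shift (M.sgn * (2 * Real.pi * δ * n.1)) (schIncl φ))
  have h5 := Lp.coeFn_smul (Complex.exp (Complex.I *
      (M.sgn * (2 * Real.pi * δ * n.1) * (-(2 * Real.pi * δ * n.2)) / 2 : ℝ)))
    (phaseMul (-(2 * Real.pi * δ * n.2)) (shift (M.sgn * (2 * Real.pi * δ * n.1)) (schIncl φ)))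
  filter_upwards [h2, h3, h4, h5] with x h2 h3 h4 h5
  refine h5.trans ?_
  rw [Pi.smul_apply, h4, h2]
  rw [Function.comp_apply, Function.comp_apply] at h3
  rw [Function.comp_apply, show schIncl φ = φ.toLp 2 volume from rfl, h3]
  rfl

theorem norm_expI_apply (δ : ℝ) (n : ℤ × ℤ) (v : Hf) : ‖M.expI δ n v‖ = ‖v‖ := by
  simp [expI, weyl, norm_smul, mul_comm Complex.I, Complex.norm_exp_ofReal_mul_I,
    -Complex.ofReal_mul, -Complex.ofReal_div, -Complex.ofReal_neg]

theorem expI_zero (n : ℤ × ℤ) (φ : Sch) : M.expI 0 n (schIncl φ) = schIncl φ := by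
  apply Lp.ext
  filter_upwards [M.expI_schIncl_ae 0 n φ, φ.coeFn_toLp 2 volume] with x hx hx'
  rw [hx, show schIncl φ = φ.toLp 2 volume from rfl, hx']
  simp [expFun]

theorem inner_expI (δ : ℝ) (n : ℤ × ℤ) (g φ : Sch) :
    inner ℂ (schIncl g) (M.expI δ n (schIncl φ))
      = ∫ x, starRingEnd ℂ (g x) * M.expFun δ n φ x := by
  rw [L2.inner_def]
  refine integral_congr_ae ?_
  filter_upwards [M.expI_schIncl_ae δ n φ, g.coeFn_toLp 2 volume] with x hx hx'
  rw [hx, show schIncl g = g.toLp 2 volume from rfl, hx']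
  simp [mul_comm]

/-- Translating the integration variable moves the shift onto the other factor; the half phase in
the Weyl operator is what makes the two multipliers agree. -/
theorem inner_expI_left (δ : ℝ) (n : ℤ × ℤ) (g φ : Sch) :
    inner ℂ (schIncl g) (M.expI δ n (schIncl φ))
      = inner ℂ (M.expI δ (-n) (schIncl g)) (schIncl φ) := by
  rw [← inner_conj_symm (M.expI δ (-n) (schIncl g)), inner_expI, inner_expI, ← integral_conj,
    ← integral_add_right_eq_self (fun x => starRingEnd ℂ (starRingEnd ℂ (φ x) * _))
      (M.sgn * (2 * Real.pi * δ * n.1))]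
  refine integral_congr_ae (Filter.Eventually.of_forall fun x => ?_)
  simp only [expFun, map_mul, Complex.conj_conj, ← Complex.exp_conj, Complex.conj_I,
    Complex.conj_ofReal, Prod.fst_neg, Prod.snd_neg]
  rw [show x + M.sgn * (2 * Real.pi * δ * n.1) + M.sgn * (2 * Real.pi * δ * (-n.1 : ℤ)) = x by
    push_cast; ring]
  have e : Complex.exp (Complex.I *
        (M.sgn * (2 * Real.pi * δ * n.1) * (-(2 * Real.pi * δ * n.2)) / 2 : ℝ)) *
      Complex.exp (Complex.I * (-(2 * Real.pi * δ * n.2) * x : ℝ))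
      = Complex.exp (-Complex.I * (M.sgn * (2 * Real.pi * δ * (-n.1 : ℤ)) *
          (-(2 * Real.pi * δ * (-n.2 : ℤ))) / 2 : ℝ)) *
        Complex.exp (-Complex.I * (-(2 * Real.pi * δ * (-n.2 : ℤ)) *
          (x + M.sgn * (2 * Real.pi * δ * n.1)) : ℝ)) := by
    rw [← Complex.exp_add, ← Complex.exp_add]
    congr 1
    push_cast
    ring
  linear_combination (starRingEnd ℂ (g x) * φ (x + M.sgn * (2 * Real.pi * δ * n.1))) * e

/-- The generator multiplies by the shifted position, while differentiating the plane wave yields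
only `x`. The derivative of the scalar prefactor, quadratic in `δ` inside the exponential, supplies
the difference. -/
theorem hasDerivAt_expFun (n : ℤ × ℤ) (φ : Sch) (δ x : ℝ) :
    HasDerivAt (fun δ => M.expFun δ n φ x) (M.expFun δ n (M.jSch n φ) x) δ := by
  have h1 : HasDerivAt (fun δ : ℝ => x + M.sgn * (2 * Real.pi * δ * n.1))
      (M.sgn * (2 * Real.pi * n.1)) δ := by
    have := ((((hasDerivAt_id δ).const_mul (2 * Real.pi)).mul_const (n.1 : ℝ)).const_mul
      M.sgn).const_add x
    simpa using this
  have h2 := (φ.hasDerivAt (x + M.sgn * (2 * Real.pi * δ * n.1))).scomp δ h1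
  have h3 : HasDerivAt (fun δ : ℝ => Complex.I * (-(2 * Real.pi * δ * n.2) * x : ℝ))
      (Complex.I * (-(2 * Real.pi * n.2) * x : ℝ)) δ := by
    have := ((((hasDerivAt_id δ).const_mul (2 * Real.pi)).mul_const (n.2 : ℝ)).neg.mul_const
      x).ofReal_comp.const_mul Complex.I
    simpa using this
  have h4 : HasDerivAt (fun δ : ℝ => Complex.I *
        (M.sgn * (2 * Real.pi * δ * n.1) * (-(2 * Real.pi * δ * n.2)) / 2 : ℝ))
      (Complex.I * (-(M.sgn * (2 * Real.pi * n.1) * (2 * Real.pi * n.2)) * δ : ℝ)) δ := by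
    have := (((hasDerivAt_pow 2 δ).const_mul
      (-(M.sgn * (2 * Real.pi * n.1) * (2 * Real.pi * n.2)) / 2)).ofReal_comp.const_mul Complex.I)
    refine (this.congr_deriv ?_).congr_of_eventuallyEq (Filter.Eventually.of_forall fun δ => ?_)
    · push_cast; ring
    · push_cast; ring
  refine (h4.cexp.mul (h3.cexp.mul h2)).congr_deriv ?_
  simp only [expFun, jSch, iSch, smul_apply, sub_apply, Q_apply, P_apply, Function.comp_apply,
    Pi.mul_apply, smul_eq_mul, Complex.real_smul]
  push_cast
  ring_nf
  simp only [Complex.I_sq]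
  ring

theorem norm_expFun (n : ℤ × ℤ) (φ : ℝ → ℂ) (δ x : ℝ) :
    ‖M.expFun δ n φ x‖ = ‖φ (x + M.sgn * (2 * Real.pi * δ * n.1))‖ := by
  simp only [expFun, norm_mul, mul_comm Complex.I, Complex.norm_exp_ofReal_mul_I, one_mul]

theorem continuous_expFun (n : ℤ × ℤ) (φ : Sch) (δ : ℝ) : Continuous (M.expFun δ n φ) := by
  unfold expFun
  have := φ.continuous
  fun_prop

/-- Differentiation under the integral: phases have modulus one, so the `δ`-derivative is dominated
by `|g|` times the supremum of `|Jφ|`, uniformly in `δ`. -/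
theorem hasDerivAt_inner_expI (n : ℤ × ℤ) (g φ : Sch) (δ : ℝ) :
    HasDerivAt (fun δ => inner ℂ (schIncl g) (M.expI δ n (schIncl φ)))
      (inner ℂ (schIncl g) (M.expI δ n (schIncl (M.jSch n φ)))) δ := by
  simp only [inner_expI]
  obtain ⟨C, hC⟩ : ∃ C, ∀ y, ‖M.jSch n φ y‖ ≤ C :=
    ⟨_, SchwartzMap.norm_le_seminorm ℝ (M.jSch n φ)⟩
  obtain ⟨D, hD⟩ : ∃ D, ∀ y, ‖φ y‖ ≤ D := ⟨_, SchwartzMap.norm_le_seminorm ℝ φ⟩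
  have hg : Integrable g := g.integrable
  have hc : Continuous fun x => starRingEnd ℂ (g x) := Complex.continuous_conj.comp g.continuous
  refine (hasDerivAt_integral_of_dominated_loc_of_deriv_le (bound := fun x => ‖g x‖ * C)
    (F' := fun δ x => starRingEnd ℂ (g x) * M.expFun δ n (M.jSch n φ) x)
    (s := Set.univ) Filter.univ_mem
    (Filter.Eventually.of_forall fun δ => (hc.mul (M.continuous_expFun n φ δ)).aestronglyMeasurable)
    ?_ (hc.mul (M.continuous_expFun n _ δ)).aestronglyMeasurable
    (Filter.Eventually.of_forall fun x δ _ => ?_) (hg.norm.mul_const C)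
    (Filter.Eventually.of_forall fun x δ _ => (M.hasDerivAt_expFun n φ δ x).const_mul _)).2
  · refine (hg.norm.mul_const D).mono' (hc.mul (M.continuous_expFun n φ δ)).aestronglyMeasurable
      (Filter.Eventually.of_forall fun x => ?_)
    rw [Pi.mul_apply, norm_mul, norm_expFun, RCLike.norm_conj]
    exact mul_le_mul_of_nonneg_left (hD _) (norm_nonneg _)
  · rw [norm_mul, norm_expFun, RCLike.norm_conj]
    exact mul_le_mul_of_nonneg_left (hC _) (norm_nonneg _)

/-- On the Schwartz space, `exp (2 π i δ I_{n,m})` commutes with its generator. -/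
theorem inner_expI_jSch (δ : ℝ) (n : ℤ × ℤ) (g φ : Sch) :
    inner ℂ (schIncl g) (M.expI δ n (schIncl (M.jSch n φ)))
      = inner ℂ (M.expI δ (-n) (schIncl (M.jSch (-n) g))) (schIncl φ) := by
  have h1 := M.hasDerivAt_inner_expI n g φ δ
  have h2 := (M.hasDerivAt_inner_expI (-n) φ g δ).star
  -- The same scalar function is expressed through mode `n` and through mode `-n`; uniqueness of its
  -- derivative replaces a direct computation of the commutation.
  have h3 : (fun δ => inner ℂ (schIncl g) (M.expI δ n (schIncl φ)))
      = fun δ => star (inner ℂ (schIncl φ) (M.expI δ (-n) (schIncl g))) := by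
    funext δ
    rw [inner_expI_left]
    exact (inner_conj_symm _ _).symm
  rw [h3] at h1
  rw [h1.unique h2]
  exact inner_conj_symm _ _

/-! ### Taylor remainders of the unitary groups -/

/-- The Taylor remainder of order `k` of `exp (2 π i δ I_{n,m}) φ`. -/
def taylorRem (δ : ℝ) (n : ℤ × ℤ) (k : ℕ) (φ : Sch) : Hf :=
  M.expI δ n (schIncl φ)
    - ∑ j ∈ Finset.range k, ((δ ^ j / j.factorial : ℝ) : ℂ) • schIncl ((M.jSch n ^ j) φ)

theorem taylorRem_succ (δ : ℝ) (n : ℤ × ℤ) (k : ℕ) (φ : Sch) :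
    M.taylorRem δ n (k + 1) φ = M.taylorRem δ n k φ
      - ((δ ^ k / k.factorial : ℝ) : ℂ) • schIncl ((M.jSch n ^ k) φ) := by
  rw [taylorRem, taylorRem, Finset.sum_range_succ, sub_add_eq_sub_sub]

theorem hasDerivAt_inner_taylorRem (n : ℤ × ℤ) (k : ℕ) (g φ : Sch) (δ : ℝ) :
    HasDerivAt (fun δ => inner ℂ (schIncl g) (M.taylorRem δ n (k + 1) φ))
      (inner ℂ (schIncl g) (M.taylorRem δ n k (M.jSch n φ))) δ := by
  induction k with
  | zero =>
    simp only [taylorRem_succ, inner_sub_right]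
    simpa [taylorRem] using (M.hasDerivAt_inner_expI n g φ δ).sub_const
      (inner ℂ (schIncl g) (schIncl φ))
  | succ k ih =>
    have h : ∀ δ, M.taylorRem δ n (k + 1 + 1) φ = _ := fun δ => M.taylorRem_succ δ n (k + 1) φ
    simp only [h, M.taylorRem_succ δ n k (M.jSch n φ), inner_sub_right, inner_smul_right]
    refine ih.sub ?_
    have e : (M.jSch n ^ (k + 1)) φ = (M.jSch n ^ k) (M.jSch n φ) := by
      rw [pow_succ]; rfl
    rw [e]
    refine HasDerivAt.mul_const ?_ _
    have h1 : HasDerivAt (fun δ : ℝ => δ ^ (k + 1) / ((k + 1).factorial : ℝ))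
        (δ ^ k / (k.factorial : ℝ)) δ := by
      refine ((hasDerivAt_pow (k + 1) δ).div_const ((k + 1).factorial : ℝ)).congr_deriv ?_
      rw [Nat.factorial_succ]
      push_cast
      field_simp
    exact h1.ofReal_comp

/-- Induction on the order: the remainder vanishes at `δ = 0` and its weak derivative is the
remainder of one order less at `Jφ`, so the mean value inequality applies. Order zero is unitarity.
The factor `1/k!` is given up, since only the power of `δ` matters. -/
theorem norm_taylorRem_le (n : ℤ × ℤ) (k : ℕ) (φ : Sch) {δ : ℝ} (hδ : 0 ≤ δ) :
    ‖M.taylorRem δ n k φ‖ ≤ δ ^ k * ‖schIncl ((M.jSch n ^ k) φ)‖ := by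
  induction k generalizing φ δ with
  | zero => simp [taylorRem, norm_expI_apply]
  | succ k ih =>
    refine norm_le_of_forall_inner_schIncl (by positivity) fun g => ?_
    have h0 : M.taylorRem 0 n (k + 1) φ = 0 := by
      rw [taylorRem, Finset.sum_range_succ']
      simp [expI_zero]
    have e : (M.jSch n ^ (k + 1)) φ = (M.jSch n ^ k) (M.jSch n φ) := by
      rw [pow_succ]; rfl
    have := norm_image_sub_le_of_norm_deriv_le_segment' (a := 0) (b := δ)
      (C := ‖schIncl g‖ * (δ ^ k * ‖schIncl ((M.jSch n ^ (k + 1)) φ)‖))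
      (fun s _ => (M.hasDerivAt_inner_taylorRem n k g φ s).hasDerivWithinAt)
      (fun s hs => by
        refine (norm_inner_le_norm _ _).trans (mul_le_mul_of_nonneg_left ?_ (norm_nonneg _))
        refine (ih (M.jSch n φ) hs.1).trans ?_
        rw [e]
        exact mul_le_mul_of_nonneg_right (pow_le_pow_left₀ hs.1 hs.2.le k) (norm_nonneg _))
      δ (Set.right_mem_Icc.2 hδ)
    rw [h0, inner_zero_right, sub_zero] at this
    refine this.trans (le_of_eq ?_)
    rw [pow_succ]; ring

end BlochLandau

namespace BlochLandau

variable (M : BlochLandau)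

/-! ### The oscillator `Ξ` and its relative bounds -/

theorem area_pos' : 0 < M.area := M.area_pos

theorem ofReal_sqrt_mul_self {x : ℝ} (hx : 0 ≤ x) : (Real.sqrt x : ℂ) * (Real.sqrt x : ℂ) = x := by
  rw [← Complex.ofReal_mul, Real.mul_self_sqrt hx]

theorem za_mul_conj_za : M.za * starRingEnd ℂ M.za = ((‖M.a‖ ^ 2 : ℝ) : ℂ) / M.area := by
  have h := ofReal_sqrt_mul_self M.area_pos'.le
  rw [za, EuclideanSpace.norm_sq_eq]
  simp only [map_div₀, map_sub, map_mul, Complex.conj_I, Complex.conj_ofReal, div_mul_div_comm, h,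
    Fin.sum_univ_two, Real.norm_eq_abs, sq_abs]
  congr 1
  push_cast
  linear_combination (-(M.a 1 : ℂ) ^ 2) * Complex.I_sq

theorem zb_mul_conj_zb : M.zb * starRingEnd ℂ M.zb = ((‖M.b‖ ^ 2 : ℝ) : ℂ) / M.area := by
  have h := ofReal_sqrt_mul_self M.area_pos'.le
  rw [zb, EuclideanSpace.norm_sq_eq]
  simp only [map_div₀, map_sub, map_mul, Complex.conj_I, Complex.conj_ofReal, div_mul_div_comm, h,
    Fin.sum_univ_two, Real.norm_eq_abs, sq_abs]
  congr 1
  push_cast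
  linear_combination (-(M.b 1 : ℂ) ^ 2) * Complex.I_sq

/-- The imaginary part is the oriented cell area divided by itself. This normalisation produces the
canonical commutator of `𝔞` and `𝔞†`. -/
theorem za_mul_conj_zb :
    M.za * starRingEnd ℂ M.zb = ((inner ℝ M.a M.b : ℝ) : ℂ) / M.area + Complex.I := by
  have h := ofReal_sqrt_mul_self M.area_pos'.le
  have h0 : (M.area : ℂ) ≠ 0 := by exact_mod_cast M.area_pos'.ne'
  rw [za, zb, PiLp.inner_apply]
  simp only [map_div₀, map_sub, map_mul, Complex.conj_I, Complex.conj_ofReal, div_mul_div_comm, h,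
    Fin.sum_univ_two, RCLike.inner_apply, conj_trivial]
  rw [div_add' _ _ _ h0]
  congr 1
  rw [area]
  push_cast
  linear_combination (-(M.a 1 : ℂ) * M.b 1) * Complex.I_sq

theorem zb_mul_conj_za :
    M.zb * starRingEnd ℂ M.za = ((inner ℝ M.a M.b : ℝ) : ℂ) / M.area - Complex.I := by
  have h := congrArg (starRingEnd ℂ) M.za_mul_conj_zb
  simp only [map_mul, Complex.conj_conj, map_add, map_div₀, Complex.conj_ofReal,
    Complex.conj_I] at h
  linear_combination h

theorem sgn_cases : (0 < M.q ∧ M.sgn = 1) ∨ (¬ 0 < M.q ∧ M.sgn = -1) := by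
  by_cases h : 0 < M.q
  · exact Or.inl ⟨h, by simp [sgn, h]⟩
  · exact Or.inr ⟨h, by simp [sgn, h]⟩

theorem Q_P_apply (φ : Sch) (x : ℝ) : Q (M.P φ) x = M.P (Q φ) x + Complex.I * M.sgn * φ x := by
  have := congrArg (fun f : Sch => f x) (M.Q_P_comm φ)
  simp only [sub_apply, smul_apply, smul_eq_mul] at this
  linear_combination this

theorem div_sqrt_two_mul : (-Complex.I / (Real.sqrt 2 : ℂ)) * (Complex.I / (Real.sqrt 2 : ℂ))
    = 1 / 2 := by
  have h : (Real.sqrt 2 : ℂ) * (Real.sqrt 2 : ℂ) = (2 : ℝ) := ofReal_sqrt_mul_self (by norm_num)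
  rw [div_mul_div_comm, h]
  simp

theorem xiSch_apply (φ : Sch) (x : ℝ) : M.xiSch φ x = ((1 / (2 * M.area) : ℝ) : ℂ) *
    (((‖M.a‖ ^ 2 : ℝ) : ℂ) * M.P (M.P φ) x + ((‖M.b‖ ^ 2 : ℝ) : ℂ) * Q (Q φ) x
      - ((inner ℝ M.a M.b : ℝ) : ℂ) * (Q (M.P φ) x + M.P (Q φ) x)) := rfl

theorem aDag_aOp (φ : Sch) :
    M.aDag (M.aOp φ) = M.xiSch φ - ((M.sgn : ℂ) / 2) • φ := by
  ext x
  have h0 : (M.area : ℂ) ≠ 0 := by exact_mod_cast M.area_pos'.ne'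
  simp only [aDag, aOp, sub_apply, smul_apply, map_sub, map_smul, smul_eq_mul, xiSch_apply,
    Q_P_apply]
  push_cast
  have e1 := M.za_mul_conj_za
  have e2 := M.zb_mul_conj_zb
  have e3 := M.za_mul_conj_zb
  have e4 := M.zb_mul_conj_za
  push_cast at e1 e2
  have e5 : (1 / (2 * (M.area : ℂ))) = 1 / 2 / M.area := by field_simp
  rw [e5]
  linear_combination (M.za * starRingEnd ℂ M.za * M.P (M.P φ) x
      - M.za * starRingEnd ℂ M.zb * M.P (Q φ) x
      - M.zb * starRingEnd ℂ M.za * (M.P (Q φ) x + Complex.I * M.sgn * φ x)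
      + M.zb * starRingEnd ℂ M.zb * Q (Q φ) x) * div_sqrt_two_mul
    + (1 / 2 * M.P (M.P φ) x) * e1 + (1 / 2 * Q (Q φ) x) * e2 - (1 / 2 * M.P (Q φ) x) * e3
    - (1 / 2 * (M.P (Q φ) x + Complex.I * M.sgn * φ x)) * e4
    + (1 / 2 * M.sgn * φ x) * Complex.I_sq

theorem aOp_aDag (φ : Sch) : M.aOp (M.aDag φ) = M.aDag (M.aOp φ) + (M.sgn : ℂ) • φ := by
  ext x
  simp only [aDag, aOp, sub_apply, add_apply, smul_apply, map_sub, map_smul, smul_eq_mul,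
    Q_P_apply]
  linear_combination (Complex.I * M.sgn * φ x *
      (M.zb * starRingEnd ℂ M.za - M.za * starRingEnd ℂ M.zb)) * div_sqrt_two_mul
    + (1 / 2 * Complex.I * M.sgn * φ x) * (M.zb_mul_conj_za - M.za_mul_conj_zb)
    - (M.sgn * φ x) * Complex.I_sq

theorem isFormalAdjoint_aOp : IsFormalAdjoint M.aOp M.aDag := by
  have := (((M.isFormalAdjoint_P.smul (starRingEnd ℂ M.za)).sub
    (isFormalAdjoint_Q.smul (starRingEnd ℂ M.zb))).smul (Complex.I / (Real.sqrt 2 : ℂ)))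
  simpa [aOp, aDag, Complex.conj_I] using this

/-- The annihilation operator, the formal adjoint of the creation operator. -/
def annihilation : Sch →L[ℂ] Sch := if 0 < M.q then M.aOp else M.aDag

theorem isFormalAdjoint_annihilation : IsFormalAdjoint M.annihilation M.creation := by
  rw [annihilation, creation]
  split_ifs
  · exact M.isFormalAdjoint_aOp
  · exact M.isFormalAdjoint_aOp.symm

/-- Exchanging the roles of `𝔞` and `𝔞†` for a negative charge absorbs the sign, so all later
estimates are independent of the charge. -/
theorem annihilation_creation (φ : Sch) :
    M.annihilation (M.creation φ) = M.creation (M.annihilation φ) + φ := by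
  rw [annihilation, creation]
  rcases M.sgn_cases with ⟨h, hs⟩ | ⟨h, hs⟩
  · simp only [h, if_true, aOp_aDag, hs]; simp
  · simp only [h, if_false, aOp_aDag, hs]; simp

theorem xiSch_eq (φ : Sch) :
    M.xiSch φ = M.creation (M.annihilation φ) + (1 / 2 : ℂ) • φ := by
  rw [annihilation, creation]
  rcases M.sgn_cases with ⟨h, hs⟩ | ⟨h, hs⟩
  · simp only [h, if_true, aDag_aOp, hs]
    module
  · simp only [h, if_false, aOp_aDag, aDag_aOp, hs]
    module

/-! ### Relative bounds for polynomials of degree at most two in `P` and `Q` -/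

/-- `T` is bounded relative to `Ξ` on the Schwartz space. -/
def XiBounded (T : Sch →L[ℂ] Sch) : Prop :=
  ∃ K : ℝ, 0 ≤ K ∧ ∀ φ, ‖schIncl (T φ)‖ ≤ K * ‖schIncl (M.xiSch φ)‖

namespace XiBounded

variable {M} {T S : Sch →L[ℂ] Sch}

theorem add (hT : M.XiBounded T) (hS : M.XiBounded S) : M.XiBounded (T + S) := by
  obtain ⟨K, hK, h⟩ := hT
  obtain ⟨L, hL, h'⟩ := hS
  refine ⟨K + L, by positivity, fun φ => ?_⟩
  rw [add_apply, map_add, add_mul]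
  exact (norm_add_le _ _).trans (add_le_add (h φ) (h' φ))

theorem smul (hT : M.XiBounded T) (c : ℂ) : M.XiBounded (c • T) := by
  obtain ⟨K, hK, h⟩ := hT
  refine ⟨‖c‖ * K, by positivity, fun φ => ?_⟩
  rw [smul_apply, map_smul, norm_smul, mul_assoc]
  exact mul_le_mul_of_nonneg_left (h φ) (norm_nonneg _)

end XiBounded

/-- The cross term of the square of `𝔠𝔠* + 1/2` is nonnegative by adjointness. Each summand on the
right is thus separately dominated by `‖Ξφ‖²`, which gives the basic relative bounds. -/
theorem norm_sq_creation_annihilation (φ : Sch) :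
    ‖schIncl (M.xiSch φ)‖ ^ 2 = ‖schIncl (M.creation (M.annihilation φ))‖ ^ 2
      + ‖schIncl (M.annihilation φ)‖ ^ 2 + (1 / 4) * ‖schIncl φ‖ ^ 2 := by
  rw [xiSch_eq, map_add, map_smul, norm_add_sq (𝕜 := ℂ), norm_smul, inner_smul_right,
    M.isFormalAdjoint_annihilation.symm (M.annihilation φ) φ, inner_self_eq_norm_sq_to_K]
  have : RCLike.re ((1 / 2 : ℂ) * ((‖schIncl (M.annihilation φ)‖ : ℂ)) ^ 2)
      = 1 / 2 * ‖schIncl (M.annihilation φ)‖ ^ 2 := by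
    rw [show (1 / 2 : ℂ) * ((‖schIncl (M.annihilation φ)‖ : ℂ)) ^ 2
      = ((1 / 2 * ‖schIncl (M.annihilation φ)‖ ^ 2 : ℝ) : ℂ) by push_cast; ring]
    exact Complex.ofReal_re _
  erw [this]
  rw [show ‖(1 / 2 : ℂ)‖ = 1 / 2 by simp]
  ring

theorem norm_sq_annihilation_sq (φ : Sch) :
    ‖schIncl (M.annihilation (M.annihilation φ))‖ ^ 2
      = ‖schIncl (M.creation (M.annihilation φ))‖ ^ 2 - ‖schIncl (M.annihilation φ)‖ ^ 2 := by
  have h := M.isFormalAdjoint_annihilation (M.annihilation φ)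
    (M.annihilation (M.annihilation φ))
  have h1 := M.annihilation_creation (M.annihilation φ)
  rw [← sub_eq_iff_eq_add] at h1
  rw [← h1, map_sub, inner_sub_right,
    ← M.isFormalAdjoint_annihilation.symm (M.annihilation φ) (M.creation (M.annihilation φ)),
    inner_self_eq_norm_sq_to_K, inner_self_eq_norm_sq_to_K, inner_self_eq_norm_sq_to_K] at h
  exact_mod_cast h

theorem norm_sq_creation_sq (φ : Sch) :
    ‖schIncl (M.creation (M.creation φ))‖ ^ 2
      = ‖schIncl (M.annihilation (M.creation φ))‖ ^ 2 + ‖schIncl (M.creation φ)‖ ^ 2 := by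
  have h := M.isFormalAdjoint_annihilation.symm (M.creation φ) (M.creation (M.creation φ))
  rw [M.annihilation_creation (M.creation φ), map_add, inner_add_right,
    ← M.isFormalAdjoint_annihilation (M.creation φ) (M.annihilation (M.creation φ)),
    inner_self_eq_norm_sq_to_K, inner_self_eq_norm_sq_to_K, inner_self_eq_norm_sq_to_K] at h
  exact_mod_cast h

theorem norm_sq_creation (φ : Sch) :
    ‖schIncl (M.creation φ)‖ ^ 2 = ‖schIncl (M.annihilation φ)‖ ^ 2 + ‖schIncl φ‖ ^ 2 := by
  have h := M.isFormalAdjoint_annihilation.symm φ (M.creation φ)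
  rw [M.annihilation_creation φ, map_add, inner_add_right,
    ← M.isFormalAdjoint_annihilation φ (M.annihilation φ),
    inner_self_eq_norm_sq_to_K, inner_self_eq_norm_sq_to_K, inner_self_eq_norm_sq_to_K] at h
  exact_mod_cast h

theorem xiBounded_of_sq {T : Sch →L[ℂ] Sch} {K : ℝ} (hK : 0 ≤ K)
    (h : ∀ φ, ‖schIncl (T φ)‖ ^ 2 ≤ K ^ 2 * ‖schIncl (M.xiSch φ)‖ ^ 2) : M.XiBounded T :=
  ⟨K, hK, fun φ => le_of_sq_le_sq (by rw [mul_pow]; exact h φ) (by positivity)⟩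

theorem xiBounded_creation_annihilation : M.XiBounded (M.creation * M.annihilation) :=
  M.xiBounded_of_sq zero_le_one fun φ => by
    rw [M.norm_sq_creation_annihilation, mul_apply_eq_comp]
    nlinarith [sq_nonneg ‖schIncl (M.annihilation φ)‖, sq_nonneg ‖schIncl φ‖]

theorem xiBounded_annihilation : M.XiBounded M.annihilation :=
  M.xiBounded_of_sq zero_le_one fun φ => by
    rw [M.norm_sq_creation_annihilation]
    nlinarith [sq_nonneg ‖schIncl (M.creation (M.annihilation φ))‖, sq_nonneg ‖schIncl φ‖]

theorem xiBounded_one : M.XiBounded 1 :=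
  M.xiBounded_of_sq zero_le_two fun φ => by
    rw [M.norm_sq_creation_annihilation, one_apply_eq_self]
    nlinarith [sq_nonneg ‖schIncl (M.creation (M.annihilation φ))‖,
      sq_nonneg ‖schIncl (M.annihilation φ)‖]

theorem xiBounded_annihilation_creation : M.XiBounded (M.annihilation * M.creation) := by
  have : M.annihilation * M.creation = M.creation * M.annihilation + 1 := by
    ext1 φ
    exact M.annihilation_creation φ
  rw [this]
  exact M.xiBounded_creation_annihilation.add M.xiBounded_one

theorem xiBounded_creation : M.XiBounded M.creation :=
  M.xiBounded_of_sq zero_le_two fun φ => by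
    rw [M.norm_sq_creation_annihilation, M.norm_sq_creation]
    nlinarith [sq_nonneg ‖schIncl (M.creation (M.annihilation φ))‖,
      sq_nonneg ‖schIncl (M.annihilation φ)‖]

theorem xiBounded_annihilation_sq : M.XiBounded (M.annihilation * M.annihilation) :=
  M.xiBounded_of_sq zero_le_one fun φ => by
    rw [M.norm_sq_creation_annihilation, mul_apply_eq_comp, M.norm_sq_annihilation_sq]
    nlinarith [sq_nonneg ‖schIncl (M.annihilation φ)‖, sq_nonneg ‖schIncl φ‖]

theorem xiBounded_creation_sq : M.XiBounded (M.creation * M.creation) := by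
  obtain ⟨K, hK, h⟩ := M.xiBounded_annihilation_creation
  obtain ⟨L, hL, h'⟩ := M.xiBounded_creation
  refine ⟨K + L, by positivity, fun φ => le_of_sq_le_sq ?_ (by positivity)⟩
  rw [mul_apply_eq_comp, M.norm_sq_creation_sq]
  have h1 := pow_le_pow_left₀ (norm_nonneg _) (h φ) 2
  have h2 := pow_le_pow_left₀ (norm_nonneg _) (h' φ) 2
  rw [mul_apply_eq_comp] at h1
  have h3 : 0 ≤ (K * ‖schIncl (M.xiSch φ)‖) * (L * ‖schIncl (M.xiSch φ)‖) := by positivity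
  nlinarith

/-- The linear system defining `𝔞`, `𝔞†` from `P`, `Q` is invertible because `z_b conj z_a - z_a
conj z_b = -2i`; eliminating `Q` leaves `P`. -/
theorem exists_P_eq : ∃ c d : ℂ, M.P = c • M.annihilation + d • M.creation := by
  suffices ∃ c d : ℂ, M.P = c • M.aOp + d • M.aDag by
    obtain ⟨c, d, h⟩ := this
    rw [annihilation, creation]
    split_ifs
    · exact ⟨c, d, h⟩
    · exact ⟨d, c, by rw [h, add_comm]⟩
  have h2 : (Real.sqrt 2 : ℂ) ≠ 0 := by
    exact_mod_cast (Real.sqrt_pos.2 zero_lt_two).ne'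
  have h3 : (Real.sqrt 2 : ℂ) ^ 2 = 2 := by exact_mod_cast Real.sq_sqrt zero_le_two
  refine ⟨M.zb / Real.sqrt 2, starRingEnd ℂ M.zb / Real.sqrt 2, ?_⟩
  ext φ x
  simp only [aOp, aDag, add_apply, sub_apply, smul_apply, smul_eq_mul]
  field_simp
  rw [h3]
  linear_combination (-Complex.I * M.P φ x) * (M.zb_mul_conj_za - M.za_mul_conj_zb)
    + 2 * M.P φ x * Complex.I_sq

theorem exists_Q_eq : ∃ c d : ℂ, Q = c • M.annihilation + d • M.creation := by
  suffices ∃ c d : ℂ, Q = c • M.aOp + d • M.aDag by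
    obtain ⟨c, d, h⟩ := this
    rw [annihilation, creation]
    split_ifs
    · exact ⟨c, d, h⟩
    · exact ⟨d, c, by rw [h, add_comm]⟩
  have h2 : (Real.sqrt 2 : ℂ) ≠ 0 := by
    exact_mod_cast (Real.sqrt_pos.2 zero_lt_two).ne'
  have h3 : (Real.sqrt 2 : ℂ) ^ 2 = 2 := by exact_mod_cast Real.sq_sqrt zero_le_two
  refine ⟨M.za / Real.sqrt 2, starRingEnd ℂ M.za / Real.sqrt 2, ?_⟩
  ext φ x
  simp only [aOp, aDag, add_apply, sub_apply, smul_apply, smul_eq_mul]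
  field_simp
  rw [h3]
  linear_combination (-Complex.I * Q φ x) * (M.zb_mul_conj_za - M.za_mul_conj_zb)
    + 2 * Q φ x * Complex.I_sq

theorem xiBounded_linear (c d : ℂ) : M.XiBounded (c • M.annihilation + d • M.creation) :=
  (M.xiBounded_annihilation.smul c).add (M.xiBounded_creation.smul d)

theorem xiBounded_quadratic (c d c' d' : ℂ) : M.XiBounded
    ((c • M.annihilation + d • M.creation) * (c' • M.annihilation + d' • M.creation)) := by
  have := ((M.xiBounded_annihilation_sq.smul (c * c')).add
    (M.xiBounded_annihilation_creation.smul (c * d'))).add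
    ((M.xiBounded_creation_annihilation.smul (d * c')).add
    (M.xiBounded_creation_sq.smul (d * d')))
  convert this using 1
  simp only [add_mul, mul_add, smul_mul_assoc, mul_smul_comm]
  module

/-- The linear combination `u Q + v P`. -/
def linSch (u v : ℂ) : Sch →L[ℂ] Sch := u • Q + v • M.P

/-- A constant which bounds all products of at most two of the operators `P` and `Q`
relative to `Ξ`. -/
theorem exists_xi_bound : ∃ K : ℝ, 0 ≤ K ∧ ∀ φ : Sch,
    ‖schIncl φ‖ ≤ K * ‖schIncl (M.xiSch φ)‖ ∧
    (∀ u v : ℂ, ‖schIncl (M.linSch u v φ)‖ ≤ K * (‖u‖ + ‖v‖) * ‖schIncl (M.xiSch φ)‖) ∧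
    ∀ u v u' v' : ℂ, ‖schIncl (M.linSch u v (M.linSch u' v' φ))‖
      ≤ K * ((‖u‖ + ‖v‖) * (‖u'‖ + ‖v'‖)) * ‖schIncl (M.xiSch φ)‖ := by
  obtain ⟨c, d, hP⟩ := M.exists_P_eq
  obtain ⟨c', d', hQ⟩ := M.exists_Q_eq
  obtain ⟨K0, h0, b0⟩ := M.xiBounded_one
  obtain ⟨KP, hKP, bP⟩ : M.XiBounded M.P := hP ▸ M.xiBounded_linear c d
  obtain ⟨KQ, hKQ, bQ⟩ : M.XiBounded Q := hQ ▸ M.xiBounded_linear c' d'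
  have hPP : M.XiBounded (M.P * M.P) := hP ▸ M.xiBounded_quadratic c d c d
  have hQQ : M.XiBounded (Q * Q) := hQ ▸ M.xiBounded_quadratic c' d' c' d'
  have hPQ : M.XiBounded (M.P * Q) := by
    rw [hP, hQ]; exact M.xiBounded_quadratic c d c' d'
  have hQP : M.XiBounded (Q * M.P) := by
    rw [hP, hQ]; exact M.xiBounded_quadratic c' d' c d
  obtain ⟨K1, h1, b1⟩ := hPP
  obtain ⟨K2, h2, b2⟩ := hQQ
  obtain ⟨K3, h3, b3⟩ := hPQ
  obtain ⟨K4, h4, b4⟩ := hQP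
  set K := K0 + KP + KQ + K1 + K2 + K3 + K4 with hK
  have mono : ∀ {L : ℝ} {φ : Sch} {w : Hf}, ‖w‖ ≤ L * ‖schIncl (M.xiSch φ)‖ → L ≤ K →
      ‖w‖ ≤ K * ‖schIncl (M.xiSch φ)‖ := fun hw hL =>
    hw.trans (mul_le_mul_of_nonneg_right hL (norm_nonneg _))
  refine ⟨K, by positivity, fun φ => ⟨mono (b0 φ) (by linarith), fun u v => ?_,
    fun u v u' v' => ?_⟩⟩
  · simp only [linSch, add_apply, smul_apply, map_add, map_smul]
    refine (norm_add_le _ _).trans ?_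
    rw [norm_smul, norm_smul]
    have e1 := mul_le_mul_of_nonneg_left (mono (bQ φ) (by linarith)) (norm_nonneg u)
    have e2 := mul_le_mul_of_nonneg_left (mono (bP φ) (by linarith)) (norm_nonneg v)
    refine (add_le_add e1 e2).trans (le_of_eq (by ring))
  · simp only [linSch, add_apply, smul_apply, map_add, map_smul]
    have e1 := mul_le_mul_of_nonneg_left (mono (b2 φ) (by linarith))
      (mul_nonneg (norm_nonneg u') (norm_nonneg u))
    have e2 := mul_le_mul_of_nonneg_left (mono (b4 φ) (by linarith))
      (mul_nonneg (norm_nonneg v') (norm_nonneg u))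
    have e3 := mul_le_mul_of_nonneg_left (mono (b3 φ) (by linarith))
      (mul_nonneg (norm_nonneg u') (norm_nonneg v))
    have e4 := mul_le_mul_of_nonneg_left (mono (b1 φ) (by linarith))
      (mul_nonneg (norm_nonneg v') (norm_nonneg v))
    simp only [mul_apply_eq_comp] at e1 e2 e3 e4
    simp only [smul_add, smul_smul]
    refine (norm_add_le _ _).trans ((add_le_add (norm_add_le _ _) (norm_add_le _ _)).trans ?_)
    simp only [norm_smul, norm_mul]
    linarith

end BlochLandau

/-! ### Fourier coefficients of smooth periodic functions -/

/-- Integration by parts over one period: the boundary terms cancel. The constant `c` carries the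
frozen other variable. -/
theorem integral_exp_mul_deriv_of_periodic {g g' : ℝ → ℂ} (c : ℂ) (n : ℤ)
    (hg : ∀ x, HasDerivAt g (g' x) x) (hg' : Continuous g') (h : g 1 = g 0) :
    ∫ x in (0 : ℝ)..1, Complex.exp (-(2 * Real.pi * Complex.I * (c + n * x))) * g' x
      = 2 * Real.pi * Complex.I * n *
        ∫ x in (0 : ℝ)..1, Complex.exp (-(2 * Real.pi * Complex.I * (c + n * x))) * g x := by
  have hu : ∀ x : ℝ, HasDerivAt
      (fun x : ℝ => Complex.exp (-(2 * Real.pi * Complex.I * (c + n * x))))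
      (Complex.exp (-(2 * Real.pi * Complex.I * (c + n * x))) *
        (-(2 * Real.pi * Complex.I * n))) x := by
    intro x
    have h1 : HasDerivAt (fun x : ℝ => (x : ℂ)) 1 x := HasDerivAt.ofReal_comp (hasDerivAt_id x)
    have := (((h1.const_mul (n : ℂ)).const_add c).const_mul (2 * Real.pi * Complex.I)).neg.cexp
    simpa using this
  rw [intervalIntegral.integral_mul_deriv_eq_deriv_mul (fun x _ => hu x) (fun x _ => hg x)
    (Continuous.intervalIntegrable (by fun_prop) _ _) (hg'.intervalIntegrable _ _)]
  have e : Complex.exp (-(2 * Real.pi * Complex.I * (c + n * (1 : ℝ))))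
      = Complex.exp (-(2 * Real.pi * Complex.I * (c + n * (0 : ℝ)))) := by
    rw [Complex.exp_eq_exp_iff_exists_int]
    exact ⟨-n, by push_cast; ring⟩
  rw [e, h, sub_self, zero_sub, ← intervalIntegral.integral_neg,
    ← intervalIntegral.integral_const_mul]
  refine intervalIntegral.integral_congr fun x _ => ?_
  ring

namespace BlochLandau

variable (M : BlochLandau)

/-- `F` is smooth and `Γ`-periodic. -/
def SmoothPeriodic (F : Plane → ℝ) : Prop :=
  ContDiff ℝ ∞ F ∧ ∀ r, F (r + M.a) = F r ∧ F (r + M.b) = F r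

variable {M} in
theorem SmoothPeriodic.fderiv {F : Plane → ℝ} (hF : M.SmoothPeriodic F) (v : Plane) :
    M.SmoothPeriodic fun r => fderiv ℝ F r v := by
  refine ⟨(hF.1.fderiv_right (m := ∞) (by norm_cast)).clm_apply contDiff_const, fun r => ?_⟩
  have h : ∀ w : Plane, (∀ r, F (r + w) = F r) → _root_.fderiv ℝ F (r + w) = _root_.fderiv ℝ F r :=
    fun w hw => by
      rw [← fderiv_comp_add_right]
      exact congrArg (fun G => _root_.fderiv ℝ G r) (funext hw)
  exact ⟨congrArg (fun L : Plane →L[ℝ] ℝ => L v) (h _ fun r => (hF.2 r).1),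
    congrArg (fun L : Plane →L[ℝ] ℝ => L v) (h _ fun r => (hF.2 r).2)⟩

theorem fourierCoef_fderiv_b {F : Plane → ℝ} (hF : M.SmoothPeriodic F) (n : ℤ × ℤ) :
    M.fourierCoef (fun r => fderiv ℝ F r M.b) n
      = 2 * Real.pi * Complex.I * n.2 * M.fourierCoef F n := by
  rw [fourierCoef, fourierCoef, ← intervalIntegral.integral_const_mul]
  refine intervalIntegral.integral_congr fun x₁ _ => ?_
  refine integral_exp_mul_deriv_of_periodic (g := fun x₂ => (F (x₁ • M.a + x₂ • M.b) : ℂ))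
    (n.1 * x₁ : ℂ) n.2 (fun x₂ => ?_) ?_ ?_
  · have h1 : HasDerivAt (fun x₂ : ℝ => x₁ • M.a + x₂ • M.b) M.b x₂ := by
      simpa using ((hasDerivAt_id x₂).smul_const M.b).const_add (x₁ • M.a)
    exact (((hF.1.differentiable (by simp)) _).hasFDerivAt.comp_hasDerivAt x₂ h1).ofReal_comp
  · have := (hF.fderiv M.b).1.continuous
    fun_prop
  · have := (hF.2 (x₁ • M.a)).2
    simp [this]

/-- Fubini makes the coordinate along `a` the inner one, so that the one-dimensional integration by
parts also covers derivatives along `a`. -/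
theorem fourierCoef_swap {F : Plane → ℝ} (hF : Continuous F) (n : ℤ × ℤ) :
    M.fourierCoef F n = ∫ x₂ in (0 : ℝ)..1, ∫ x₁ in (0 : ℝ)..1,
      Complex.exp (-(2 * Real.pi * Complex.I * (n.2 * x₂ + n.1 * x₁))) *
        (F (x₁ • M.a + x₂ • M.b) : ℂ) := by
  rw [fourierCoef, intervalIntegral_intervalIntegral_swap]
  · simp only [add_comm ((n.1 : ℂ) * _)]
  · have : Continuous (Function.uncurry fun x₁ x₂ : ℝ =>
        Complex.exp (-(2 * Real.pi * Complex.I * (n.1 * x₁ + n.2 * x₂))) *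
          (F (x₁ • M.a + x₂ • M.b) : ℂ)) := by
      unfold Function.uncurry
      fun_prop
    exact (this.continuousOn.integrableOn_compact (isCompact_uIcc.prod isCompact_uIcc)).mono_set
      (Set.prod_mono Set.uIoc_subset_uIcc Set.uIoc_subset_uIcc)

theorem fourierCoef_fderiv_a {F : Plane → ℝ} (hF : M.SmoothPeriodic F) (n : ℤ × ℤ) :
    M.fourierCoef (fun r => fderiv ℝ F r M.a) n
      = 2 * Real.pi * Complex.I * n.1 * M.fourierCoef F n := by
  rw [M.fourierCoef_swap (hF.fderiv M.a).1.continuous, M.fourierCoef_swap hF.1.continuous,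
    ← intervalIntegral.integral_const_mul]
  refine intervalIntegral.integral_congr fun x₂ _ => ?_
  refine integral_exp_mul_deriv_of_periodic (g := fun x₁ => (F (x₁ • M.a + x₂ • M.b) : ℂ))
    (n.2 * x₂ : ℂ) n.1 (fun x₁ => ?_) ?_ ?_
  · have h1 : HasDerivAt (fun x₁ : ℝ => x₁ • M.a + x₂ • M.b) M.a x₁ := by
      simpa using ((hasDerivAt_id x₁).smul_const M.a).add_const (x₂ • M.b)
    exact (((hF.1.differentiable (by simp)) _).hasFDerivAt.comp_hasDerivAt x₁ h1).ofReal_comp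
  · have := (hF.fderiv M.a).1.continuous
    fun_prop
  · have := (hF.2 (x₂ • M.b)).1
    simp [add_comm M.a, this]

theorem fourierCoef_neg (F : Plane → ℝ) (n : ℤ × ℤ) :
    M.fourierCoef F (-n) = starRingEnd ℂ (M.fourierCoef F n) := by
  simp only [fourierCoef, ← intervalIntegral.intervalIntegral_conj]
  refine intervalIntegral.integral_congr fun x₁ _ => intervalIntegral.integral_congr fun x₂ _ => ?_
  simp only [map_mul, ← Complex.exp_conj, Complex.conj_ofReal, map_neg, map_add, Complex.conj_I,
    Complex.conj_ofNat, map_intCast, Prod.fst_neg, Prod.snd_neg]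
  congr 2
  push_cast
  ring

theorem norm_fourierCoef_le {F : Plane → ℝ} (hF : Continuous F) :
    ∃ C : ℝ, ∀ n, ‖M.fourierCoef F n‖ ≤ C := by
  have hc : Continuous fun y : ℝ × ℝ => F (y.1 • M.a + y.2 • M.b) := by fun_prop
  obtain ⟨C, hC⟩ := (isCompact_Icc.prod isCompact_Icc).exists_bound_of_continuousOn
    (s := Set.Icc (0 : ℝ) 1 ×ˢ Set.Icc (0 : ℝ) 1) hc.continuousOn
  refine ⟨C, fun n => ?_⟩
  have key := intervalIntegral.norm_integral_le_of_norm_le_const (a := (0 : ℝ)) (b := 1) (C := C)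
    (f := fun x₁ : ℝ => ∫ x₂ in (0 : ℝ)..1,
      Complex.exp (-(2 * Real.pi * Complex.I * (n.1 * x₁ + n.2 * x₂))) *
        (F (x₁ • M.a + x₂ • M.b) : ℂ)) fun x₁ h₁ => by
    have := intervalIntegral.norm_integral_le_of_norm_le_const (a := (0 : ℝ)) (b := 1) (C := C)
      (f := fun x₂ : ℝ => Complex.exp (-(2 * Real.pi * Complex.I * (n.1 * x₁ + n.2 * x₂))) *
        (F (x₁ • M.a + x₂ • M.b) : ℂ)) fun x₂ h₂ => by
      rw [Set.uIoc_of_le zero_le_one] at h₁ h₂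
      have e : (-(2 * Real.pi * Complex.I * (n.1 * x₁ + n.2 * x₂)) : ℂ)
          = ((-(2 * Real.pi * (n.1 * x₁ + n.2 * x₂)) : ℝ) : ℂ) * Complex.I := by
        push_cast; ring
      rw [norm_mul, e, Complex.norm_exp_ofReal_mul_I, one_mul, Complex.norm_real]
      exact hC (x₁, x₂) ⟨⟨h₁.1.le, h₁.2⟩, ⟨h₂.1.le, h₂.2⟩⟩
    simpa using this
  simpa [fourierCoef] using key

/-- The weight `1 + |n| + |m|` on the dual lattice. -/
def weight (n : ℤ × ℤ) : ℝ := 1 + |(n.1 : ℝ)| + |(n.2 : ℝ)|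

theorem one_le_weight (n : ℤ × ℤ) : 1 ≤ weight n := by
  have := abs_nonneg (n.1 : ℝ)
  have := abs_nonneg (n.2 : ℝ)
  unfold weight
  linarith

/-- One more factor `1 + |n| + |m|` costs one derivative: the three summands are controlled by the
coefficients of `F`, `∂_a F` and `∂_b F`, with `2π ≥ 1`. Generalizing over `F` lets the induction
reach the derivatives. -/
theorem weight_mul_norm_fourierCoef_le (K : ℕ) {F : Plane → ℝ} (hF : M.SmoothPeriodic F) :
    ∃ C : ℝ, ∀ n, weight n ^ K * ‖M.fourierCoef F n‖ ≤ C := by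
  induction K generalizing F with
  | zero => simpa using M.norm_fourierCoef_le hF.1.continuous
  | succ K ih =>
    obtain ⟨C0, h0⟩ := ih hF
    obtain ⟨C1, h1⟩ := ih (hF.fderiv M.a)
    obtain ⟨C2, h2⟩ := ih (hF.fderiv M.b)
    refine ⟨C0 + C1 + C2, fun n => ?_⟩
    have h1 := h1 n
    have h2 := h2 n
    have hp : ∀ k : ℤ, ‖(2 * Real.pi * Complex.I * k : ℂ)‖ = 2 * Real.pi * |(k : ℝ)| := by
      intro k
      simp [abs_of_pos Real.pi_pos]
    rw [fourierCoef_fderiv_a M hF, norm_mul, hp] at h1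
    rw [fourierCoef_fderiv_b M hF, norm_mul, hp] at h2
    have h3 : (1 : ℝ) ≤ 2 * Real.pi := by linarith [Real.pi_gt_three]
    have h4 : 0 ≤ weight n ^ K * ‖M.fourierCoef F n‖ :=
      mul_nonneg (pow_nonneg (zero_le_one.trans (one_le_weight n)) K) (norm_nonneg _)
    have h5 := mul_le_mul_of_nonneg_right h3 (mul_nonneg h4 (abs_nonneg (n.1 : ℝ)))
    have h6 := mul_le_mul_of_nonneg_right h3 (mul_nonneg h4 (abs_nonneg (n.2 : ℝ)))
    have h7 : weight n ^ (K + 1) * ‖M.fourierCoef F n‖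
        = weight n ^ K * ‖M.fourierCoef F n‖ * (1 + |(n.1 : ℝ)| + |(n.2 : ℝ)|) := by
      rw [pow_succ]; unfold weight; ring
    rw [h7]
    have h0 := h0 n
    nlinarith

theorem summable_inv_weight : Summable fun n : ℤ × ℤ => (weight n ^ 4)⁻¹ := by
  have h : Summable fun k : ℤ => ((1 + |(k : ℝ)|) ^ 2)⁻¹ := by
    have h1 : Summable fun k : ℤ => 1 / (k : ℝ) ^ 2 :=
      Real.summable_one_div_int_pow.2 one_lt_two
    -- The indicator of `0` covers the term `k = 0`, where `1 / k ^ 2` takes the value `0`.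
    refine (h1.add (summable_of_hasFiniteSupport (f := fun k : ℤ => if k = 0 then (1 : ℝ) else 0)
      ((Set.finite_singleton 0).subset fun k hk => by
        by_contra h
        exact hk (if_neg h)))).of_nonneg_of_le (fun k => by positivity) fun k => ?_
    rcases eq_or_ne k 0 with rfl | hk
    · simp
    · have : 0 < |(k : ℝ)| := abs_pos.2 (by exact_mod_cast hk)
      simp only [hk, if_false, add_zero, one_div]
      rw [← sq_abs (k : ℝ)]
      gcongr
      linarith
  refine (h.mul_of_nonneg h (fun k => by positivity) fun k => by positivity).of_nonneg_of_le
    (fun n => by have := one_le_weight n; positivity) fun n => ?_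
  rw [← mul_inv]
  have h1 := abs_nonneg (n.1 : ℝ)
  have h2 := abs_nonneg (n.2 : ℝ)
  have e : weight n ^ 4 = weight n ^ 2 * weight n ^ 2 := by ring
  rw [e]
  have e1 : 1 + |(n.1 : ℝ)| ≤ weight n := by unfold weight; linarith
  have e2 : 1 + |(n.2 : ℝ)| ≤ weight n := by unfold weight; linarith
  exact inv_anti₀ (by positivity) (mul_le_mul (pow_le_pow_left₀ (by positivity) e1 2)
    (pow_le_pow_left₀ (by positivity) e2 2) (by positivity) (by positivity))

theorem summable_weight_mul_fourierCoef (K : ℕ) {F : Plane → ℝ} (hF : M.SmoothPeriodic F) :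
    Summable fun n => weight n ^ K * ‖M.fourierCoef F n‖ := by
  obtain ⟨C, hC⟩ := M.weight_mul_norm_fourierCoef_le (K + 4) hF
  refine (summable_inv_weight.mul_left C).of_nonneg_of_le
    (fun n => by have := one_le_weight n; positivity) fun n => ?_
  have h := one_le_weight n
  rw [← div_eq_mul_inv, le_div_iff₀ (by positivity)]
  refine le_trans (le_of_eq ?_) (hC n)
  ring

/-! ### The dimensionless potentials -/

variable {M}

theorem AssumptionAs.contDiff_AΓ (hs : M.AssumptionAs) : ContDiff ℝ ∞ M.AΓ :=
  contDiff_euclidean.2 fun j => (hs.2 j).1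

theorem AssumptionAs.smoothPeriodic_potV (hs : M.AssumptionAs) : M.SmoothPeriodic M.potV := by
  refine ⟨?_, fun r => ?_⟩
  · unfold potV
    exact (hs.1.1.add (contDiff_const.mul (hs.contDiff_AΓ.norm_sq ℝ))).div_const _
  · simp only [potV, (M.V_per r).1, (M.V_per r).2, (M.A_per r).1, (M.A_per r).2, and_self]

theorem AssumptionAs.smoothPeriodic_potF₁ (hs : M.AssumptionAs) : M.SmoothPeriodic M.potF₁ := by
  refine ⟨?_, fun r => ?_⟩
  · unfold potF₁
    exact contDiff_const.mul (contDiff_const.inner ℝ hs.contDiff_AΓ)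
  · simp only [potF₁, (M.A_per r).1, (M.A_per r).2, and_self]

theorem AssumptionAs.smoothPeriodic_potF₂ (hs : M.AssumptionAs) : M.SmoothPeriodic M.potF₂ := by
  refine ⟨?_, fun r => ?_⟩
  · unfold potF₂
    exact contDiff_const.mul (contDiff_const.inner ℝ hs.contDiff_AΓ)
  · simp only [potF₂, (M.A_per r).1, (M.A_per r).2, and_self]

theorem fderiv_const_mul_inner (hs : M.AssumptionAs) (κ : ℝ) (u v r : Plane) :
    fderiv ℝ (fun r => κ * inner ℝ u (M.AΓ r)) r v
      = κ * (u 0 * (v 0 * fderiv ℝ (fun r => M.AΓ r 0) r (EuclideanSpace.single 0 1)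
          + v 1 * fderiv ℝ (fun r => M.AΓ r 0) r (EuclideanSpace.single 1 1))
        + u 1 * (v 0 * fderiv ℝ (fun r => M.AΓ r 1) r (EuclideanSpace.single 0 1)
          + v 1 * fderiv ℝ (fun r => M.AΓ r 1) r (EuclideanSpace.single 1 1))) := by
  have hd : ∀ j, HasFDerivAt (fun r => M.AΓ r j) (fderiv ℝ (fun r => M.AΓ r j) r) r :=
    fun j => (((hs.2 j).1.differentiable (by simp)) r).hasFDerivAt
  have h := (((hd 0).const_mul (u 0)).add ((hd 1).const_mul (u 1))).const_mul κ
  have e : (fun r => κ * inner ℝ u (M.AΓ r))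
      = fun r => κ * (u 0 * M.AΓ r 0 + u 1 * M.AΓ r 1) := by
    funext r
    simp [PiLp.inner_apply, Fin.sum_univ_two, mul_comm]
  have hv : v = v 0 • EuclideanSpace.single 0 1 + v 1 • EuclideanSpace.single 1 1 := by
    ext i
    fin_cases i <;> simp
  rw [e]
  erw [h.fderiv]
  conv_lhs => rw [hv]
  simp only [map_add, map_smul, add_apply, smul_apply, smul_eq_mul]
  ring

/-- In lattice coordinates the divergence of `A_Γ` is `∂_a(a*·A_Γ) + ∂_b(b*·A_Γ)`, by duality of the
two bases. The gauge condition then passes to Fourier coefficients. -/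
theorem fourierCoef_div_free (hs : M.AssumptionAs) (hdiv : M.DivFree) (n : ℤ × ℤ) :
    n.1 * M.fourierCoef M.potF₁ n + n.2 * M.fourierCoef M.potF₂ n = 0 := by
  have h1 := M.fourierCoef_fderiv_a hs.smoothPeriodic_potF₁ n
  have h2 := M.fourierCoef_fderiv_b hs.smoothPeriodic_potF₂ n
  have h3 : (fun r => fderiv ℝ M.potF₂ r M.b) = fun r => -fderiv ℝ M.potF₁ r M.a := by
    funext r
    have hd := hdiv r
    rw [Fin.sum_univ_two] at hd
    have e1 := fderiv_const_mul_inner hs (2 * Real.pi * (M.chargeNumber * M.area / M.fluxQuantum))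
      M.aStar M.a r
    have e2 := fderiv_const_mul_inner hs (2 * Real.pi * (M.chargeNumber * M.area / M.fluxQuantum))
      M.bStar M.b r
    change fderiv ℝ M.potF₁ r M.a = _ at e1
    change fderiv ℝ M.potF₂ r M.b = _ at e2
    rw [e1, e2]
    have ha := M.area_pos'.ne'
    simp only [aStar, bStar, PiLp.toLp_apply, Matrix.cons_val_zero, Matrix.cons_val_one]
    linear_combination (2 * Real.pi * (M.chargeNumber * M.area / M.fluxQuantum) *
      ((M.a 0 * M.b 1 - M.a 1 * M.b 0) / M.area)) * hd
  have h4 : M.fourierCoef (fun r => -fderiv ℝ M.potF₁ r M.a) n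
      = -M.fourierCoef (fun r => fderiv ℝ M.potF₁ r M.a) n := by
    simp [fourierCoef, intervalIntegral.integral_neg]
  rw [h3, h4, h1] at h2
  have h5 : (2 * Real.pi * Complex.I : ℂ) ≠ 0 := by simp [Real.pi_ne_zero]
  apply mul_left_cancel₀ h5
  linear_combination -h2

end BlochLandau

/-! ### Graphs of unbounded operators -/

theorem mem_graph_iff_exists {T : Hf →ₗ.[ℂ] Hf} {ψ v : Hf} :
    (ψ, v) ∈ T.graph ↔ ∃ h : ψ ∈ T.domain, T ⟨ψ, h⟩ = v := by
  rw [LinearPMap.mem_graph_iff]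
  constructor
  · rintro ⟨⟨y, hy⟩, rfl, h2⟩
    exact ⟨hy, h2⟩
  · rintro ⟨h, h2⟩
    exact ⟨⟨ψ, h⟩, rfl, h2⟩

section Graph

variable {S T : Hf →ₗ.[ℂ] Hf} {ψ v w : Hf}

theorem add_mem_graph (hS : (ψ, v) ∈ S.graph) (hT : (ψ, w) ∈ T.graph) :
    (ψ, v + w) ∈ (S + T).graph := by
  rw [mem_graph_iff_exists] at *
  obtain ⟨h, rfl⟩ := hS
  obtain ⟨h', rfl⟩ := hT
  exact ⟨⟨h, h'⟩, rfl⟩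

theorem sub_mem_graph (hS : (ψ, v) ∈ S.graph) (hT : (ψ, w) ∈ T.graph) :
    (ψ, v - w) ∈ (S - T).graph := by
  rw [mem_graph_iff_exists] at *
  obtain ⟨h, rfl⟩ := hS
  obtain ⟨h', rfl⟩ := hT
  exact ⟨⟨h, h'⟩, rfl⟩

theorem smul_mem_graph (c : ℂ) (hT : (ψ, v) ∈ T.graph) : (ψ, c • v) ∈ (c • T).graph := by
  rw [mem_graph_iff_exists] at *
  obtain ⟨h, rfl⟩ := hT
  exact ⟨h, rfl⟩

theorem zero_mem_graph : (ψ, 0) ∈ (0 : Hf →ₗ.[ℂ] Hf).graph :=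
  mem_graph_iff_exists.2 ⟨trivial, rfl⟩

theorem sum_mem_graph {ι : Type} (s : Finset ι) (T : ι → Hf →ₗ.[ℂ] Hf) (v : ι → Hf)
    (h : ∀ i ∈ s, (ψ, v i) ∈ (T i).graph) : (ψ, ∑ i ∈ s, v i) ∈ (∑ i ∈ s, T i).graph := by
  classical
  induction s using Finset.induction_on with
  | empty => exact zero_mem_graph
  | insert i s hi ih =>
    rw [Finset.sum_insert hi, Finset.sum_insert hi]
    exact add_mem_graph (h i (Finset.mem_insert_self i s))
      (ih fun j hj => h j (Finset.mem_insert_of_mem hj))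

theorem toPMap_mem_graph (L : Hf →L[ℂ] Hf) : (ψ, L ψ) ∈ (L.toLinearMap.toPMap ⊤).graph :=
  mem_graph_iff_exists.2 ⟨trivial, rfl⟩

theorem compPMap_mem_graph (L : Hf →L[ℂ] Hf) (hT : (ψ, v) ∈ T.graph) :
    (ψ, L v) ∈ (L.toLinearMap.compPMap T).graph := by
  rw [mem_graph_iff_exists] at *
  obtain ⟨h, rfl⟩ := hT
  exact ⟨h, rfl⟩

theorem opSeries_mem_graph {ι : Type} {T : ι → Hf →ₗ.[ℂ] Hf} {v : ι → Hf}
    (h : ∀ i, (ψ, v i) ∈ (T i).graph) (hv : Summable v) :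
    (ψ, ∑' i, v i) ∈ (opSeries T).graph := by
  simp only [mem_graph_iff_exists] at *
  choose h e using h
  obtain rfl : (fun i => T i ⟨ψ, h i⟩) = v := funext e
  exact ⟨⟨h, hv⟩, rfl⟩

end Graph

/-! ### Closures of operators given on the Hermite span -/

theorem schIncl_injective : Function.Injective schIncl := fun _ _ h =>
  SchwartzMap.injective_toLp 2 volume h

theorem IsFormalAdjoint.unique {T T' T'' : Sch →L[ℂ] Sch} (h : IsFormalAdjoint T T')
    (h' : IsFormalAdjoint T T'') : T' = T'' := by
  ext1 χ
  apply schIncl_injective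
  rw [← sub_eq_zero]
  refine eq_zero_of_forall_inner_schIncl fun g => ?_
  rw [inner_sub_right, ← h, ← h', sub_self]

namespace BlochLandau

variable (M : BlochLandau)

theorem onHermite_graph (T : Sch →L[ℂ] Sch) :
    (M.onHermite T).graph = M.hermiteSpan.map
      (schIncl.toLinearMap.prod (schIncl ∘L T).toLinearMap) := by
  refine Submodule.toLinearPMap_graph_eq _ ?_
  rintro _ ⟨φ, -, rfl⟩ h
  have : φ = 0 := schIncl_injective (by simpa using h)
  simp [this]

theorem mem_onHermite_graph {T : Sch →L[ℂ] Sch} {y : Hf × Hf} :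
    y ∈ (M.onHermite T).graph ↔ ∃ φ ∈ M.hermiteSpan, (schIncl φ, schIncl (T φ)) = y := by
  rw [onHermite_graph]
  rfl

/-- A formal adjoint on the dense Schwartz space forces closability: pairing with a test function
determines the second component of a limit from the first. Without closability the closure would
carry a default value. -/
theorem closedOp_graph {T T' : Sch →L[ℂ] Sch} (h : IsFormalAdjoint T T') :
    (M.closedOp T).graph = (M.onHermite T).graph.topologicalClosure := by
  have key : ∀ y ∈ (M.onHermite T).graph.topologicalClosure, ∀ g : Sch,
      inner ℂ (schIncl g) y.2 = inner ℂ (schIncl (T' g)) y.1 := by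
    intro y hy g
    have hc : IsClosed {y : Hf × Hf | inner ℂ (schIncl g) y.2 = inner ℂ (schIncl (T' g)) y.1} :=
      isClosed_eq (by fun_prop) (by fun_prop)
    refine closure_minimal ?_ hc hy
    intro z hz
    obtain ⟨φ, -, rfl⟩ := M.mem_onHermite_graph.1 hz
    exact (h.symm g φ).symm
  have hcl : (M.onHermite T).IsClosable := by
    refine ⟨(M.onHermite T).graph.topologicalClosure.toLinearPMap, ?_⟩
    rw [Submodule.toLinearPMap_graph_eq]
    intro y hy h0
    refine eq_zero_of_forall_inner_schIncl fun g => ?_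
    rw [key y hy, h0, inner_zero_right]
  rw [closedOp, hcl.graph_closure_eq_closure_graph]

theorem isFormalAdjoint_xiSch : IsFormalAdjoint M.xiSch M.xiSch := by
  have hP := M.isFormalAdjoint_P
  have hQ := isFormalAdjoint_Q
  have := (((hP.mul hP).smul ((‖M.a‖ ^ 2 : ℝ) : ℂ)).add
    ((hQ.mul hQ).smul ((‖M.b‖ ^ 2 : ℝ) : ℂ))).sub
    (((hQ.mul hP).add (hP.mul hQ)).smul ((inner ℝ M.a M.b : ℝ) : ℂ))
  have := this.smul ((1 / (2 * M.area) : ℝ) : ℂ)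
  simp only [Complex.conj_ofReal] at this
  rw [add_comm (M.P * Q)] at this
  exact this

/-! ### Approximation in the graph norm of `Ξ` -/

/-- The sequence `φ` in `𝓛` converges to `ψ` in the graph norm of `Ξ`, with `Ξ ψ = η`. -/
structure IsApprox (φ : ℕ → Sch) (ψ η : Hf) : Prop where
  mem : ∀ k, φ k ∈ M.hermiteSpan
  tendsto : Filter.Tendsto (fun k => schIncl (φ k)) Filter.atTop (nhds ψ)
  tendsto_xi : Filter.Tendsto (fun k => schIncl (M.xiSch (φ k))) Filter.atTop (nhds η)

theorem isApprox_const {χ : Sch} (h : χ ∈ M.hermiteSpan) :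
    M.IsApprox (fun _ => χ) (schIncl χ) (schIncl (M.xiSch χ)) :=
  ⟨fun _ => h, tendsto_const_nhds, tendsto_const_nhds⟩

theorem exists_isApprox (ψ : M.xi.domain) : ∃ φ, M.IsApprox φ ψ (M.xi ψ) := by
  have h : ((ψ : Hf), M.xi ψ) ∈ M.xi.graph := M.xi.mem_graph ψ
  have e : M.xi.graph = _ := M.closedOp_graph M.isFormalAdjoint_xiSch
  rw [e] at h
  obtain ⟨y, hy, hlim⟩ := mem_closure_iff_seq_limit.1 h
  choose φ hφ e using fun k => M.mem_onHermite_graph.1 (hy k)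
  have h1 := hlim.fst_nhds
  have h2 := hlim.snd_nhds
  simp only [← e] at h1 h2
  exact ⟨φ, hφ, h1, h2⟩

namespace IsApprox

variable {M} {φ : ℕ → Sch} {ψ η : Hf}

theorem mem_xi_graph (h : M.IsApprox φ ψ η) : (ψ, η) ∈ M.xi.graph := by
  rw [xi, M.closedOp_graph M.isFormalAdjoint_xiSch]
  exact mem_closure_of_tendsto (h.tendsto.prodMk_nhds h.tendsto_xi)
    (Filter.Eventually.of_forall fun k => M.mem_onHermite_graph.2 ⟨φ k, h.mem k, rfl⟩)

theorem mem_closedOp_graph (h : M.IsApprox φ ψ η) {T T' : Sch →L[ℂ] Sch}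
    (hT : IsFormalAdjoint T T') {v : Hf}
    (hv : Filter.Tendsto (fun k => schIncl (T (φ k))) Filter.atTop (nhds v)) :
    (ψ, v) ∈ (M.closedOp T).graph := by
  rw [M.closedOp_graph hT]
  exact mem_closure_of_tendsto (h.tendsto.prodMk_nhds hv)
    (Filter.Eventually.of_forall fun k => M.mem_onHermite_graph.2 ⟨φ k, h.mem k, rfl⟩)

theorem exists_tendsto (h : M.IsApprox φ ψ η) {T : Sch →L[ℂ] Sch} {K : ℝ} (hK : 0 ≤ K)
    (hT : ∀ χ, ‖schIncl (T χ)‖ ≤ K * ‖schIncl (M.xiSch χ)‖) :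
    ∃ v, Filter.Tendsto (fun k => schIncl (T (φ k))) Filter.atTop (nhds v) := by
  refine cauchySeq_tendsto_of_complete (Metric.cauchySeq_iff.2 fun ε hε => ?_)
  -- `K + 1` rather than `K`, since `K` may vanish.
  obtain ⟨N, hN⟩ := Metric.cauchySeq_iff.1 h.tendsto_xi.cauchySeq (ε / (K + 1)) (by positivity)
  refine ⟨N, fun k hk l hl => ?_⟩
  have h1 := hN k hk l hl
  rw [dist_eq_norm, ← map_sub, ← map_sub, lt_div_iff₀ (by positivity)] at h1
  rw [dist_eq_norm, ← map_sub, ← map_sub]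
  refine (hT _).trans_lt (lt_of_le_of_lt ?_ h1)
  nlinarith [norm_nonneg (schIncl (M.xiSch (φ k - φ l)))]

theorem norm_le (h : M.IsApprox φ ψ η) {u : Sch → Hf} {K : ℝ}
    (hu : ∀ χ, ‖u χ‖ ≤ K * ‖schIncl (M.xiSch χ)‖) {v : Hf}
    (hv : Filter.Tendsto (fun k => u (φ k)) Filter.atTop (nhds v)) : ‖v‖ ≤ K * ‖η‖ :=
  le_of_tendsto_of_tendsto' hv.norm (h.tendsto_xi.norm.const_mul K) fun k => hu (φ k)

end IsApprox

/-! ### Bounds for the terms of the expansion -/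

/-- `f^{(1)}_{n,m} Q + f^{(2)}_{n,m} P` on Schwartz functions. -/
def fSch (n : ℤ × ℤ) : Sch →L[ℂ] Sch := M.linSch (M.fourierCoef M.potF₁ n) (M.fourierCoef M.potF₂ n)

theorem iSch_eq_linSch (n : ℤ × ℤ) : M.iSch n = M.linSch (-(n.2 : ℂ)) n.1 := by
  simp [iSch, linSch]; abel

theorem norm_add_norm_le_weight (n : ℤ × ℤ) : ‖-(n.2 : ℂ)‖ + ‖(n.1 : ℂ)‖ ≤ weight n := by
  simp only [norm_neg, Complex.norm_intCast, weight]
  linarith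

theorem nat_cases : M.nat = 0 ∨ (M.nat = 1 ∧ M.AΓ = 0) := by
  by_cases h : M.AΓ = 0
  · exact Or.inr ⟨by simp [nat, h], h⟩
  · exact Or.inl (by simp [nat, h])

theorem fSch_eq_zero (h : M.AΓ = 0) (n : ℤ × ℤ) : M.fSch n = 0 := by
  have h1 : M.potF₁ = 0 := by funext r; simp [potF₁, h]
  have h2 : M.potF₂ = 0 := by funext r; simp [potF₂, h]
  simp [fSch, linSch, h1, h2, fourierCoef]

variable {M}

theorem AssumptionAs.summable_vectorBound (hs : M.AssumptionAs) (K : ℕ) : Summable fun n =>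
    weight n ^ K * (‖M.fourierCoef M.potF₁ n‖ + ‖M.fourierCoef M.potF₂ n‖) := by
  simp only [mul_add]
  exact (M.summable_weight_mul_fourierCoef K hs.smoothPeriodic_potF₁).add
    (M.summable_weight_mul_fourierCoef K hs.smoothPeriodic_potF₂)

variable (M)

/-- The admitted powers are `j ≤ 2♮ ≤ 2`, exactly within reach of the quadratic relative bound. -/
theorem exists_norm_iSch_pow_le : ∃ K : ℝ, 0 ≤ K ∧ ∀ j < 2 * M.nat + 1, ∀ n φ,
    ‖schIncl ((M.iSch n ^ j) φ)‖ ≤ K * weight n ^ 2 * ‖schIncl (M.xiSch φ)‖ := by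
  obtain ⟨K, hK, h⟩ := M.exists_xi_bound
  refine ⟨K, hK, fun j hj n φ => ?_⟩
  have hw := one_le_weight n
  have hn := norm_add_norm_le_weight n
  have hj' : j < 3 := by
    rcases M.nat_cases with h | ⟨h, -⟩ <;> omega
  obtain ⟨h0, h1, h2⟩ := h φ
  interval_cases j
  · refine h0.trans (mul_le_mul_of_nonneg_right ?_ (norm_nonneg _))
    exact le_mul_of_one_le_right hK (one_le_pow₀ hw)
  · rw [pow_one, iSch_eq_linSch]
    refine (h1 _ _).trans ?_
    gcongr
    exact hn.trans (le_self_pow₀ hw two_ne_zero)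
  · rw [pow_two, iSch_eq_linSch, mul_apply_eq_comp, pow_two]
    refine (h2 _ _ _ _).trans ?_
    gcongr

/-- For `♮ = 0` at most one `I_n` precedes the linear factor, so the product is quadratic. For `♮ =
1` higher powers are harmless because the linear factor is zero. This is why the truncation order
depends on `♮`. -/
theorem exists_norm_iSch_pow_fSch_le : ∃ K : ℝ, 0 ≤ K ∧ ∀ j < 2 * (1 + M.nat), ∀ n φ,
    ‖schIncl ((M.iSch n ^ j) (M.fSch n φ))‖
      ≤ K * (weight n ^ 1 * (‖M.fourierCoef M.potF₁ n‖ + ‖M.fourierCoef M.potF₂ n‖)) *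
        ‖schIncl (M.xiSch φ)‖ := by
  obtain ⟨K, hK, h⟩ := M.exists_xi_bound
  refine ⟨K, hK, fun j hj n φ => ?_⟩
  have hw := one_le_weight n
  have hw0 : 0 ≤ weight n := zero_le_one.trans hw
  have hn := norm_add_norm_le_weight n
  rcases M.nat_cases with h0 | ⟨-, hA⟩
  · have hj' : j < 2 := by omega
    obtain ⟨-, h1, h2⟩ := h φ
    rw [pow_one]
    interval_cases j
    · refine (h1 _ _).trans ?_
      gcongr
      exact le_mul_of_one_le_left (by positivity) hw
    · rw [pow_one, iSch_eq_linSch]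
      refine (h2 _ _ _ _).trans ?_
      gcongr
  · rw [M.fSch_eq_zero hA]
    simp only [zero_apply, map_zero, norm_zero]
    positivity

/-- With `φ` fixed the power is unrestricted: the innermost `I_n` is expanded onto `φ`, each step
costing one factor of the weight, while the constant depends on `φ` and `j` only. -/
theorem exists_norm_iSch_pow_apply_le (j : ℕ) (φ : Sch) : ∃ C : ℝ, 0 ≤ C ∧ ∀ n,
    ‖schIncl ((M.iSch n ^ j) φ)‖ ≤ C * weight n ^ j := by
  induction j generalizing φ with
  | zero => exact ⟨‖schIncl φ‖, norm_nonneg _, fun n => by simp⟩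
  | succ j ih =>
    obtain ⟨C, hC, h⟩ := ih (M.P φ)
    obtain ⟨D, hD, h'⟩ := ih (Q φ)
    refine ⟨C + D, by positivity, fun n => ?_⟩
    have hw0 : 0 ≤ weight n := zero_le_one.trans (one_le_weight n)
    have e : (M.iSch n ^ (j + 1)) φ
        = (n.1 : ℂ) • (M.iSch n ^ j) (M.P φ) - (n.2 : ℂ) • (M.iSch n ^ j) (Q φ) := by
      rw [pow_succ, mul_apply_eq_comp, iSch, sub_apply, smul_apply, smul_apply, map_sub, map_smul,
        map_smul]
    rw [e, map_sub, map_smul, map_smul]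
    refine (norm_sub_le _ _).trans ?_
    rw [norm_smul, norm_smul, Complex.norm_intCast, Complex.norm_intCast]
    have a1 : |(n.1 : ℝ)| ≤ weight n := by
      unfold weight; linarith [abs_nonneg (n.2 : ℝ)]
    have a2 : |(n.2 : ℝ)| ≤ weight n := by
      unfold weight; linarith [abs_nonneg (n.1 : ℝ)]
    have b1 := mul_le_mul a1 (h n) (norm_nonneg _) hw0
    have b2 := mul_le_mul a2 (h' n) (norm_nonneg _) hw0
    refine (add_le_add b1 b2).trans (le_of_eq ?_)
    rw [pow_succ]; ring

theorem exists_norm_iSch_pow_fSch_apply_le (j : ℕ) (φ : Sch) : ∃ C : ℝ, 0 ≤ C ∧ ∀ n,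
    ‖schIncl ((M.iSch n ^ j) (M.fSch n φ))‖
      ≤ C * (weight n ^ j * (‖M.fourierCoef M.potF₁ n‖ + ‖M.fourierCoef M.potF₂ n‖)) := by
  obtain ⟨C, hC, h⟩ := M.exists_norm_iSch_pow_apply_le j (Q φ)
  obtain ⟨D, hD, h'⟩ := M.exists_norm_iSch_pow_apply_le j (M.P φ)
  refine ⟨C + D, by positivity, fun n => ?_⟩
  have hw0 : 0 ≤ weight n := zero_le_one.trans (one_le_weight n)
  simp only [fSch, linSch, add_apply, smul_apply, map_add, map_smul]
  refine (norm_add_le _ _).trans ?_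
  rw [norm_smul, norm_smul]
  have b1 := mul_le_mul_of_nonneg_left (h n) (norm_nonneg (M.fourierCoef M.potF₁ n))
  have b2 := mul_le_mul_of_nonneg_left (h' n) (norm_nonneg (M.fourierCoef M.potF₂ n))
  have b3 : 0 ≤ C * weight n ^ j * ‖M.fourierCoef M.potF₂ n‖ := by positivity
  have b4 : 0 ≤ D * weight n ^ j * ‖M.fourierCoef M.potF₁ n‖ := by positivity
  linarith

end BlochLandau

namespace BlochLandau

variable (M : BlochLandau)

/-! ### The terms of the remainder and their symmetry -/

theorem norm_phase (p x : ℝ) (n : ℤ × ℤ) : ‖phase p x n‖ = 1 := by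
  rw [phase, show (2 * Real.pi * Complex.I * (n.1 * p + n.2 * x) : ℂ)
    = ((2 * Real.pi * (n.1 * p + n.2 * x) : ℝ) : ℂ) * Complex.I by push_cast; ring,
    Complex.norm_exp_ofReal_mul_I]

theorem phase_neg (p x : ℝ) (n : ℤ × ℤ) : phase p x (-n) = starRingEnd ℂ (phase p x n) := by
  simp only [phase, ← Complex.exp_conj, map_mul, map_add, Complex.conj_ofReal, Complex.conj_I,
    Complex.conj_ofNat, map_intCast, Prod.fst_neg, Prod.snd_neg]
  congr 1
  push_cast
  ring

/-- The contribution of the Fourier mode `n` to the remainder symbol. -/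
def remTerm (δ p x : ℝ) (n : ℤ × ℤ) (χ : Sch) : Hf :=
  phase p x n • ((δ : ℂ) • M.taylorRem δ n (2 * M.nat + 1 + 1) (M.fSch n χ)
    + ((δ ^ 2 : ℝ) : ℂ) • M.fourierCoef M.potV n • M.taylorRem δ n (2 * M.nat + 1) χ)

theorem isFormalAdjoint_fSch (n : ℤ × ℤ) : IsFormalAdjoint (M.fSch n) (M.fSch (-n)) := by
  have := (isFormalAdjoint_Q.smul (M.fourierCoef M.potF₁ n)).add
    (M.isFormalAdjoint_P.smul (M.fourierCoef M.potF₂ n))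
  simpa only [fSch, linSch, fourierCoef_neg] using this

variable {M}

/-- The gauge relation `n f¹ + m f² = 0` says that `(f¹, f²)` is proportional to `(-m, n)`. The
proportionality constant is read off from a nonzero index, hence the case split. -/
theorem exists_fSch_eq_smul_jSch (hs : M.AssumptionAs) (hdiv : M.DivFree) {n : ℤ × ℤ}
    (hn : n ≠ 0) : ∃ μ : ℂ, M.fSch n = μ • M.jSch n := by
  have h := fourierCoef_div_free hs hdiv n
  suffices ∃ μ : ℂ, M.fSch n = μ • M.iSch n by
    obtain ⟨μ, h⟩ := this
    have hpi : (2 * Real.pi * Complex.I : ℂ) ≠ 0 := by simp [Real.pi_ne_zero]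
    exact ⟨μ / (2 * Real.pi * Complex.I), by rw [h, jSch, smul_smul, div_mul_cancel₀ _ hpi]⟩
  set u := M.fourierCoef M.potF₁ n with hu
  set v := M.fourierCoef M.potF₂ n with hv
  have key : ∀ μ : ℂ, u = -(μ * n.2) → v = μ * n.1 → M.fSch n = μ • M.iSch n := by
    intro μ h1 h2
    rw [fSch, linSch, ← hu, ← hv, h1, h2, iSch]
    module
  by_cases h1 : n.1 = 0
  · have h2 : n.2 ≠ 0 := fun h2 => hn (Prod.ext h1 h2)
    have h2' : (n.2 : ℂ) ≠ 0 := by exact_mod_cast h2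
    refine ⟨-u / n.2, key _ (by field_simp) ?_⟩
    rw [h1] at h ⊢
    simpa [h2] using h
  · have h1' : (n.1 : ℂ) ≠ 0 := by exact_mod_cast h1
    refine ⟨v / n.1, key _ ?_ (by field_simp)⟩
    field_simp
    linear_combination h

theorem commute_jSch_fSch (hs : M.AssumptionAs) (hdiv : M.DivFree) (n : ℤ × ℤ) :
    Commute (M.jSch n) (M.fSch n) := by
  by_cases hn : n = 0
  · have : M.jSch n = 0 := by simp [hn, jSch, iSch]
    rw [this]
    exact Commute.zero_left _
  · obtain ⟨μ, h⟩ := exists_fSch_eq_smul_jSch hs hdiv hn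
    rw [h]
    exact (Commute.refl _).smul_right μ

theorem inner_expI_fSch (hs : M.AssumptionAs) (hdiv : M.DivFree) (δ : ℝ) (n : ℤ × ℤ)
    (g φ : Sch) : inner ℂ (schIncl g) (M.expI δ n (schIncl (M.fSch n φ)))
      = inner ℂ (M.expI δ (-n) (schIncl (M.fSch (-n) g))) (schIncl φ) := by
  -- The gauge condition says nothing about the zero mode, but there the exponential is the
  -- identity.
  by_cases hn : n = 0
  · subst hn
    have h : ∀ χ : Sch, M.expI δ 0 (schIncl χ) = schIncl χ := fun χ => by
      apply Lp.ext
      filter_upwards [M.expI_schIncl_ae δ 0 χ, χ.coeFn_toLp 2 volume] with x hx hx'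
      rw [hx, show schIncl χ = χ.toLp 2 volume from rfl, hx']
      simp [expFun]
    have h1 := M.isFormalAdjoint_fSch 0
    rw [neg_zero] at h1 ⊢
    rw [h, h, h1]
  · obtain ⟨μ, h⟩ := exists_fSch_eq_smul_jSch hs hdiv hn
    have h1 := M.isFormalAdjoint_fSch n
    have h2 := (M.isFormalAdjoint_jSch n).smul μ
    rw [← h] at h2
    -- Two formal adjoints of the same operator agree, so mode `-n` is a multiple of its generator
    -- with the conjugate constant.
    rw [h1.unique h2, h]
    simp only [smul_apply, map_smul, inner_smul_left, inner_smul_right, inner_expI_jSch,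
      Complex.conj_conj]

theorem inner_taylorRem (δ : ℝ) (n : ℤ × ℤ) (k : ℕ) (g φ : Sch) :
    inner ℂ (schIncl g) (M.taylorRem δ n k φ)
      = inner ℂ (M.taylorRem δ (-n) k g) (schIncl φ) := by
  simp only [taylorRem, inner_sub_left, inner_sub_right, inner_expI_left, inner_sum, sum_inner,
    inner_smul_left, inner_smul_right, Complex.conj_ofReal]
  congr 1
  refine Finset.sum_congr rfl fun j _ => ?_
  rw [((M.isFormalAdjoint_jSch n).pow j).symm]

theorem inner_taylorRem_fSch (hs : M.AssumptionAs) (hdiv : M.DivFree) (δ : ℝ) (n : ℤ × ℤ) (k : ℕ)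
    (g φ : Sch) : inner ℂ (schIncl g) (M.taylorRem δ n k (M.fSch n φ))
      = inner ℂ (M.taylorRem δ (-n) k (M.fSch (-n) g)) (schIncl φ) := by
  simp only [taylorRem, inner_sub_left, inner_sub_right, inner_expI_fSch hs hdiv, inner_sum,
    sum_inner, inner_smul_left, inner_smul_right, Complex.conj_ofReal]
  congr 1
  refine Finset.sum_congr rfl fun j _ => ?_
  have h := ((commute_jSch_fSch hs hdiv (-n)).pow_left j).eq
  rw [← mul_apply_eq_comp (M.jSch (-n) ^ j), h, mul_apply_eq_comp,
    (M.isFormalAdjoint_fSch n).symm, ((M.isFormalAdjoint_jSch n).pow j).symm]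

/-- Reality of the potentials and of the phases' arguments makes conjugation equal to `n ↦ -n`, so
adjunction permutes the modes. -/
theorem inner_remTerm (hs : M.AssumptionAs) (hdiv : M.DivFree) (δ p x : ℝ) (n : ℤ × ℤ)
    (g φ : Sch) : inner ℂ (schIncl g) (M.remTerm δ p x n φ)
      = inner ℂ (M.remTerm δ p x (-n) g) (schIncl φ) := by
  simp only [remTerm, inner_smul_left, inner_smul_right, inner_add_left, inner_add_right,
    Complex.conj_ofReal, inner_taylorRem_fSch hs hdiv, phase_neg, fourierCoef_neg,
    Complex.conj_conj, M.inner_taylorRem δ n (2 * M.nat + 1) g φ]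

/-! ### Bounds for the terms of the remainder -/

variable (M)

theorem norm_jSch_pow (n : ℤ × ℤ) (j : ℕ) (φ : Sch) :
    ‖schIncl ((M.jSch n ^ j) φ)‖ = (2 * Real.pi) ^ j * ‖schIncl ((M.iSch n ^ j) φ)‖ := by
  rw [jSch_pow, smul_apply, map_smul, norm_smul, norm_pow]
  simp [abs_of_pos Real.pi_pos]

/-- Trades one power of `δ` for one fewer factor of the generator by splitting off the last Taylor
term. This keeps the required operators within the relative bounds. -/
theorem norm_taylorRem_succ_le (n : ℤ × ℤ) (k : ℕ) (φ : Sch) {δ : ℝ} (hδ : 0 ≤ δ) :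
    ‖M.taylorRem δ n (k + 1) φ‖ ≤ 2 * δ ^ k * ‖schIncl ((M.jSch n ^ k) φ)‖ := by
  rw [taylorRem_succ]
  refine (norm_sub_le _ _).trans ?_
  have h1 := M.norm_taylorRem_le n k φ hδ
  have h2 : ‖((δ ^ k / k.factorial : ℝ) : ℂ) • schIncl ((M.jSch n ^ k) φ)‖
      ≤ δ ^ k * ‖schIncl ((M.jSch n ^ k) φ)‖ := by
    rw [norm_smul, Complex.norm_real, Real.norm_of_nonneg (by positivity)]
    refine mul_le_mul_of_nonneg_right (div_le_self (by positivity) ?_) (norm_nonneg _)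
    exact_mod_cast k.factorial_pos
  linarith

theorem norm_remTerm_le (δ p x : ℝ) (hδ : 0 ≤ δ) (n : ℤ × ℤ) (χ : Sch) :
    ‖M.remTerm δ p x n χ‖ ≤ δ * ‖M.taylorRem δ n (2 * M.nat + 1 + 1) (M.fSch n χ)‖
      + δ ^ 2 * (‖M.fourierCoef M.potV n‖ * ‖M.taylorRem δ n (2 * M.nat + 1) χ‖) := by
  rw [remTerm, norm_smul, norm_phase, one_mul]
  refine (norm_add_le _ _).trans (le_of_eq ?_)
  rw [norm_smul, norm_smul, norm_smul, Complex.norm_real, Complex.norm_real,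
    Real.norm_of_nonneg hδ, Real.norm_of_nonneg (by positivity)]

variable {M}

theorem exists_norm_remTerm_le (hs : M.AssumptionAs) : ∃ G : ℤ × ℤ → ℝ, Summable G ∧
    ∀ δ : ℝ, 0 < δ → ∀ p x n χ, ‖M.remTerm δ p x n χ‖
      ≤ δ ^ (2 * (M.nat + 1)) * G n * ‖schIncl (M.xiSch χ)‖ := by
  obtain ⟨K, hK, h⟩ := M.exists_norm_iSch_pow_le
  obtain ⟨L, hL, h'⟩ := M.exists_norm_iSch_pow_fSch_le
  refine ⟨fun n => 2 * (2 * Real.pi) ^ (2 * M.nat + 1) * L * (weight n ^ 1 *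
      (‖M.fourierCoef M.potF₁ n‖ + ‖M.fourierCoef M.potF₂ n‖))
    + 2 * (2 * Real.pi) ^ (2 * M.nat) * K * (weight n ^ 2 * ‖M.fourierCoef M.potV n‖),
    ((hs.summable_vectorBound 1).mul_left _).add
      ((M.summable_weight_mul_fourierCoef 2 hs.smoothPeriodic_potV).mul_left _),
    fun δ hδ p x n χ => ?_⟩
  refine (M.norm_remTerm_le δ p x hδ.le n χ).trans ?_
  have h1 := M.norm_taylorRem_succ_le n (2 * M.nat + 1) (M.fSch n χ) hδ.le
  have h2 := M.norm_taylorRem_succ_le n (2 * M.nat) χ hδ.le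
  rw [norm_jSch_pow] at h1 h2
  have h3 := h' (2 * M.nat + 1) (by omega) n χ
  have h4 := h (2 * M.nat) (by omega) n χ
  set X := ‖schIncl (M.xiSch χ)‖
  set B := weight n ^ 1 * (‖M.fourierCoef M.potF₁ n‖ + ‖M.fourierCoef M.potF₂ n‖)
  calc _ ≤ δ * (2 * δ ^ (2 * M.nat + 1) * ((2 * Real.pi) ^ (2 * M.nat + 1) * (L * B * X)))
      + δ ^ 2 * (‖M.fourierCoef M.potV n‖ * (2 * δ ^ (2 * M.nat) *
        ((2 * Real.pi) ^ (2 * M.nat) * (K * weight n ^ 2 * X)))) := by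
        refine add_le_add (mul_le_mul_of_nonneg_left (h1.trans ?_) hδ.le)
          (mul_le_mul_of_nonneg_left (mul_le_mul_of_nonneg_left (h2.trans ?_) (norm_nonneg _))
            (by positivity))
        · gcongr
        · gcongr
    _ = _ := by ring

theorem exists_norm_remTerm_apply_le (hs : M.AssumptionAs) (χ : Sch) :
    ∃ G : ℤ × ℤ → ℝ, Summable G ∧ ∀ δ : ℝ, 0 < δ → ∀ p x n, ‖M.remTerm δ p x n χ‖
      ≤ δ ^ (2 * (M.nat + 1) + 1) * G n := by
  obtain ⟨K, hK, h⟩ := M.exists_norm_iSch_pow_apply_le (2 * M.nat + 1) χ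
  obtain ⟨L, hL, h'⟩ := M.exists_norm_iSch_pow_fSch_apply_le (2 * M.nat + 1 + 1) χ
  refine ⟨fun n => (2 * Real.pi) ^ (2 * M.nat + 1 + 1) * L * (weight n ^ (2 * M.nat + 1 + 1) *
      (‖M.fourierCoef M.potF₁ n‖ + ‖M.fourierCoef M.potF₂ n‖))
    + (2 * Real.pi) ^ (2 * M.nat + 1) * K *
      (weight n ^ (2 * M.nat + 1) * ‖M.fourierCoef M.potV n‖),
    ((hs.summable_vectorBound _).mul_left _).add
      ((M.summable_weight_mul_fourierCoef _ hs.smoothPeriodic_potV).mul_left _),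
    fun δ hδ p x n => ?_⟩
  refine (M.norm_remTerm_le δ p x hδ.le n χ).trans ?_
  have h1 := M.norm_taylorRem_le n (2 * M.nat + 1 + 1) (M.fSch n χ) hδ.le
  have h2 := M.norm_taylorRem_le n (2 * M.nat + 1) χ hδ.le
  rw [norm_jSch_pow] at h1 h2
  have h3 := h' n
  have h4 := h n
  set B := weight n ^ (2 * M.nat + 1 + 1) *
    (‖M.fourierCoef M.potF₁ n‖ + ‖M.fourierCoef M.potF₂ n‖)
  calc _ ≤ δ * (δ ^ (2 * M.nat + 1 + 1) * ((2 * Real.pi) ^ (2 * M.nat + 1 + 1) * (L * B)))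
      + δ ^ 2 * (‖M.fourierCoef M.potV n‖ * (δ ^ (2 * M.nat + 1) *
        ((2 * Real.pi) ^ (2 * M.nat + 1) * (K * weight n ^ (2 * M.nat + 1))))) := by
        refine add_le_add (mul_le_mul_of_nonneg_left (h1.trans ?_) hδ.le)
          (mul_le_mul_of_nonneg_left (mul_le_mul_of_nonneg_left (h2.trans ?_) (norm_nonneg _))
            (by positivity))
        · gcongr
        · gcongr
    _ = _ := by ring

end BlochLandau

namespace BlochLandau

variable {M : BlochLandau}

/-! ### The remainder symbol on the domain of `Ξ` -/

theorem taylorRem_eq (δ : ℝ) (n : ℤ × ℤ) (k : ℕ) (φ : Sch) :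
    M.taylorRem δ n k φ = M.expI δ n (schIncl φ) - ∑ j ∈ Finset.range k,
      ((δ ^ j : ℝ) : ℂ) • ((2 * Real.pi * Complex.I) ^ j / (j.factorial : ℂ)) •
        schIncl ((M.iSch n ^ j) φ) := by
  rw [taylorRem]
  congr 1
  refine Finset.sum_congr rfl fun j _ => ?_
  rw [jSch_pow, smul_apply, map_smul, smul_smul, smul_smul]
  congr 1
  push_cast
  ring

theorem sum_Icc_one_smul (δ : ℝ) (N : ℕ) (w v : ℕ → Hf) (hv : v 1 = 0) :
    ∑ j ∈ Finset.Icc 1 (N + 1), ((δ ^ j : ℝ) : ℂ) • (w j + v j)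
      = (δ : ℂ) • ∑ j ∈ Finset.range (N + 1), ((δ ^ j : ℝ) : ℂ) • w (j + 1)
        + ((δ ^ 2 : ℝ) : ℂ) • ∑ j ∈ Finset.range N, ((δ ^ j : ℝ) : ℂ) • v (j + 2) := by
  have h : Finset.Icc 1 (N + 1) = Finset.Ico 1 (N + 2) := by ext; simp; omega
  rw [h, Finset.sum_Ico_eq_sum_range]
  simp only [smul_add, Finset.sum_add_distrib, Finset.smul_sum, smul_smul, ← Complex.ofReal_mul]
  rw [show N + 2 - 1 = N + 1 by omega]
  congr 1
  · refine Finset.sum_congr rfl fun j _ => ?_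
    rw [add_comm 1 j, pow_succ']
  -- The scalar part starts at `δ²`, so its sum has one term fewer than the vector part.
  · rw [Finset.sum_range_succ', hv, smul_zero, add_zero]
    refine Finset.sum_congr rfl fun j _ => ?_
    rw [show 1 + (j + 1) = j + 2 by omega, pow_add, mul_comm]

open Filter Topology in
theorem IsApprox.exists_mem_remainder_graph (hs : M.AssumptionAs) {φ : ℕ → Sch} {ψ η : Hf}
    (h : M.IsApprox φ ψ η) (δ p x : ℝ) : ∃ (R : Hf) (ρ : ℤ × ℤ → Hf),
      (ψ, R) ∈ (M.remainder δ p x).graph ∧ HasSum ρ R ∧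
      ∀ n, Tendsto (fun k => M.remTerm δ p x n (φ k)) atTop (𝓝 (ρ n)) := by
  obtain ⟨K, hK, bI⟩ := M.exists_norm_iSch_pow_le
  obtain ⟨L, hL, bF⟩ := M.exists_norm_iSch_pow_fSch_le
  obtain ⟨KX, hKX, bX⟩ := M.exists_xi_bound
  have hw : ∀ n, 0 ≤ weight n := fun n => zero_le_one.trans (one_le_weight n)
  -- the limits of the terms along the approximating sequence
  have ea : ∀ n j, ∃ v, j < 2 * M.nat + 1 + 1 →
      Tendsto (fun k => schIncl ((M.iSch n ^ j) (M.fSch n (φ k)))) atTop (𝓝 v) := fun n j => by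
    by_cases hj : j < 2 * M.nat + 1 + 1
    · obtain ⟨v, hv⟩ := h.exists_tendsto (T := M.iSch n ^ j * M.fSch n)
        (mul_nonneg hL (mul_nonneg (pow_nonneg (hw n) 1) (by positivity)))
        (bF j (by omega) n)
      exact ⟨v, fun _ => hv⟩
    · exact ⟨0, fun h => absurd h hj⟩
  choose a ha using ea
  have eb : ∀ n j, ∃ v, j < 2 * M.nat + 1 →
      Tendsto (fun k => schIncl ((M.iSch n ^ j) (φ k))) atTop (𝓝 v) := fun n j => by
    by_cases hj : j < 2 * M.nat + 1
    · obtain ⟨v, hv⟩ := h.exists_tendsto (T := M.iSch n ^ j)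
        (mul_nonneg hK (pow_nonneg (hw n) 2)) (bI j hj n)
      exact ⟨v, fun _ => hv⟩
    · exact ⟨0, fun h => absurd h hj⟩
  choose b hb using eb
  have na : ∀ j < 2 * M.nat + 1 + 1, Summable fun n => ‖a n j‖ := fun j hj =>
    ((((hs.summable_vectorBound 1).mul_left L).mul_right ‖η‖).of_nonneg_of_le
      (fun n => norm_nonneg _) fun n =>
        h.norm_le (u := fun χ => schIncl ((M.iSch n ^ j) (M.fSch n χ))) (bF j (by omega) n)
          (ha n j hj))
  have nb : ∀ j < 2 * M.nat + 1, Summable fun n => ‖M.fourierCoef M.potV n‖ * ‖b n j‖ :=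
    fun j hj => by
      refine (((M.summable_weight_mul_fourierCoef 2 hs.smoothPeriodic_potV).mul_left
        K).mul_right ‖η‖).of_nonneg_of_le (fun n => by positivity) fun n => ?_
      have := mul_le_mul_of_nonneg_left
        (h.norm_le (u := fun χ => schIncl ((M.iSch n ^ j) χ)) (bI j hj n) (hb n j hj))
        (norm_nonneg (M.fourierCoef M.potV n))
      refine this.trans (le_of_eq (by ring))
  have b0 : ∀ n, b n 0 = ψ := fun n =>
    tendsto_nhds_unique (by simpa using hb n 0 (by omega)) h.tendsto
  have sa : ∀ j < 2 * M.nat + 1 + 1, Summable fun n => phase p x n • a n j := fun j hj =>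
    Summable.of_norm (by simpa only [norm_smul, norm_phase, one_mul] using na j hj)
  have sb : ∀ j < 2 * M.nat + 1,
      Summable fun n => (phase p x n * M.fourierCoef M.potV n) • b n j := fun j hj =>
    Summable.of_norm (by simpa only [norm_smul, norm_mul, norm_phase, one_mul] using nb j hj)
  have sW : Summable fun n => phase p x n • M.expI δ n (a n 0) :=
    Summable.of_norm (by
      simpa only [norm_smul, norm_phase, one_mul, norm_expI_apply] using na 0 (by omega))
  have sV : Summable fun n => (M.fourierCoef M.potV n * phase p x n) • M.expI δ n ψ :=
    Summable.of_norm (by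
      simpa only [norm_smul, norm_mul, norm_phase, mul_one, norm_expI_apply, b0]
        using nb 0 (by omega))
  -- membership in the graphs
  obtain ⟨q, hq⟩ := h.exists_tendsto (T := Q) (K := KX) hKX fun χ => by
    simpa [linSch] using (bX χ).2.1 1 0
  obtain ⟨r, hr⟩ := h.exists_tendsto (T := M.P) (K := KX) hKX fun χ => by
    simpa [linSch] using (bX χ).2.1 0 1
  -- `symW` combines the closures of `Q` and `P`, whereas `coefW` closes their combination; along
  -- the approximating sequence both give the same vector.
  have a0 : ∀ n, a n 0 = M.fourierCoef M.potF₁ n • q + M.fourierCoef M.potF₂ n • r := fun n => by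
    refine tendsto_nhds_unique (ha n 0 (by omega)) ?_
    simpa [fSch, linSch] using (hq.const_smul (M.fourierCoef M.potF₁ n)).add
      (hr.const_smul (M.fourierCoef M.potF₂ n))
  have gW : (ψ, ∑' n, phase p x n • M.expI δ n (a n 0)) ∈ (M.symW δ p x).graph :=
    opSeries_mem_graph (fun n => smul_mem_graph _ (compPMap_mem_graph _ (by
      rw [a0]
      exact add_mem_graph (smul_mem_graph _ (h.mem_closedOp_graph isFormalAdjoint_Q hq))
        (smul_mem_graph _ (h.mem_closedOp_graph M.isFormalAdjoint_P hr))))) sW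
  have gV : (ψ, ∑' n, (M.fourierCoef M.potV n * phase p x n) • M.expI δ n ψ)
      ∈ (M.symV δ p x).graph :=
    opSeries_mem_graph (fun n => smul_mem_graph _ (toPMap_mem_graph _)) sV
  set e : ℕ → ℂ := fun j => (2 * Real.pi * Complex.I) ^ j / (j.factorial : ℂ) with he
  set w : ℕ → Hf := fun j => e (j - 1) • ∑' n, phase p x n • a n (j - 1) with hwdef
  -- The case split reproduces the vanishing coefficients and guards the truncated subtraction `j -
  -- 2`.
  set v : ℕ → Hf := fun j => if j ≤ 1 then 0 else
    e (j - 2) • ∑' n, (phase p x n * M.fourierCoef M.potV n) • b n (j - 2) with hvdef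
  have gH : ∀ j ∈ Finset.Icc 1 (2 * (1 + M.nat)),
      (ψ, ((δ ^ j : ℝ) : ℂ) • (w j + v j)) ∈ (((δ ^ j : ℝ) : ℂ) • M.coefH p x j).graph := by
    intro j hj
    obtain ⟨h1, h2⟩ := Finset.mem_Icc.1 hj
    refine smul_mem_graph _ (add_mem_graph ?_ ?_)
    · obtain ⟨i, rfl⟩ := Nat.exists_eq_add_of_le' h1
      exact smul_mem_graph _ (opSeries_mem_graph (fun n => smul_mem_graph _
        (h.mem_closedOp_graph
          (((M.isFormalAdjoint_iSch n).pow i).mul (M.isFormalAdjoint_fSch n))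
          (ha n i (by omega)))) (sa i (by omega)))
    · match j, h1, h2 with
      | 1, _, _ => exact zero_mem_graph
      | i + 2, _, h2 =>
        exact smul_mem_graph _ (opSeries_mem_graph (fun n => smul_mem_graph _
          (h.mem_closedOp_graph ((M.isFormalAdjoint_iSch n).pow i)
            (hb n i (by omega)))) (sb i (by omega)))
  have gR := sub_mem_graph
    (add_mem_graph (add_mem_graph h.mem_xi_graph (smul_mem_graph (δ : ℂ) gW))
      (smul_mem_graph ((δ ^ 2 : ℝ) : ℂ) gV))
    (add_mem_graph h.mem_xi_graph (sum_mem_graph _ _ _ gH))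
  refine ⟨_, fun n => phase p x n • ((δ : ℂ) • (M.expI δ n (a n 0)
      - ∑ j ∈ Finset.range (2 * M.nat + 1 + 1), ((δ ^ j : ℝ) : ℂ) • e j • a n j)
    + ((δ ^ 2 : ℝ) : ℂ) • M.fourierCoef M.potV n • (M.expI δ n ψ
      - ∑ j ∈ Finset.range (2 * M.nat + 1), ((δ ^ j : ℝ) : ℂ) • e j • b n j)), gR, ?_,
    fun n => ?_⟩
  -- Every series converges separately, so the finite sums over powers of `δ` may be exchanged with
  -- the sum over modes.
  · have hW := sW.hasSum.sub (hasSum_sum (s := Finset.range (2 * M.nat + 1 + 1))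
      fun j hj => ((sa j (Finset.mem_range.1 hj)).hasSum.const_smul (e j)).const_smul
        ((δ ^ j : ℝ) : ℂ))
    have hV := sV.hasSum.sub (hasSum_sum (s := Finset.range (2 * M.nat + 1))
      fun j hj => ((sb j (Finset.mem_range.1 hj)).hasSum.const_smul (e j)).const_smul
        ((δ ^ j : ℝ) : ℂ))
    have key := (hW.const_smul (δ : ℂ)).add (hV.const_smul ((δ ^ 2 : ℝ) : ℂ))
    convert key using 1
    · funext n
      simp only [smul_add, smul_sub, Finset.smul_sum, smul_smul]
      congr 1
      · congr 1
        · congr 1; ring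
        · refine Finset.sum_congr rfl fun j _ => ?_
          congr 1; ring
      · congr 1
        · congr 1; ring
        · refine Finset.sum_congr rfl fun j _ => ?_
          congr 1; ring
    · rw [show 2 * (1 + M.nat) = 2 * M.nat + 1 + 1 by ring,
        sum_Icc_one_smul δ (2 * M.nat + 1) w v (by simp [hvdef])]
      simp only [hwdef, hvdef, Nat.add_sub_cancel]
      have : ∀ j, ¬ (j + 2 ≤ 1) := fun j => by omega
      simp only [this, if_false, smul_sub]
      abel
  · simp only [remTerm, taylorRem_eq]
    refine (Tendsto.add (Tendsto.const_smul (Tendsto.sub ?_ ?_) _)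
      (Tendsto.const_smul (Tendsto.const_smul (Tendsto.sub ?_ ?_) _) _)).const_smul _
    · exact ((M.expI δ n).continuous.tendsto _).comp (ha n 0 (by omega))
    · exact tendsto_finsetSum _ fun j hj =>
        ((ha n j (Finset.mem_range.1 hj)).const_smul _).const_smul _
    · exact ((M.expI δ n).continuous.tendsto _).comp h.tendsto
    · exact tendsto_finsetSum _ fun j hj =>
        ((hb n j (Finset.mem_range.1 hj)).const_smul _).const_smul _

theorem exists_normFLe_remainder (hs : M.AssumptionAs) : ∃ C : ℝ, ∀ δ : ℝ, 0 < δ → ∀ p x : ℝ,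
    M.NormFLe (M.remainder δ p x) (C * δ ^ (2 * (M.nat + 1))) := by
  obtain ⟨G, hG, hb⟩ := exists_norm_remTerm_le hs
  refine ⟨∑' n, G n, fun δ hδ p x ψ => ?_⟩
  obtain ⟨φ, hφ⟩ := M.exists_isApprox ψ
  obtain ⟨R, ρ, hR, hsum, hlim⟩ := hφ.exists_mem_remainder_graph hs δ p x
  obtain ⟨hd, rfl⟩ := mem_graph_iff_exists.1 hR
  refine ⟨hd, ?_⟩
  have h1 : ∀ n, ‖ρ n‖ ≤ δ ^ (2 * (M.nat + 1)) * G n * ‖M.xi ψ‖ := fun n =>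
    hφ.norm_le (hb δ hδ p x n) (hlim n)
  have h2 := tsum_of_norm_bounded
    ((hG.hasSum.mul_left (δ ^ (2 * (M.nat + 1)))).mul_right ‖M.xi ψ‖) h1
  rw [hsum.tsum_eq] at h2
  rwa [mul_comm (∑' n, G n)]

theorem exists_remainder_hermiteSpan_le (hs : M.AssumptionAs) {χ : Sch}
    (hχ : χ ∈ M.hermiteSpan) : ∃ C : ℝ, ∀ δ : ℝ, 0 < δ → ∀ p x : ℝ, ∃ R : Hf,
      (schIncl χ, R) ∈ (M.remainder δ p x).graph ∧ ‖R‖ ≤ C * δ ^ (2 * (M.nat + 1) + 1) := by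
  obtain ⟨G, hG, hb⟩ := exists_norm_remTerm_apply_le hs χ
  refine ⟨∑' n, G n, fun δ hδ p x => ?_⟩
  obtain ⟨R, ρ, hR, hsum, hlim⟩ := (M.isApprox_const hχ).exists_mem_remainder_graph hs δ p x
  refine ⟨R, hR, ?_⟩
  -- The approximating sequence is constant, so the limits are the terms themselves and the bound
  -- without loss of order applies.
  have h1 : ∀ n, ‖ρ n‖ ≤ δ ^ (2 * (M.nat + 1) + 1) * G n := fun n => by
    rw [tendsto_nhds_unique (hlim n) tendsto_const_nhds]
    exact hb δ hδ p x n
  have h2 := tsum_of_norm_bounded (hG.hasSum.mul_left (δ ^ (2 * (M.nat + 1) + 1))) h1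
  rw [hsum.tsum_eq] at h2
  rwa [mul_comm (∑' n, G n)]

/-- The remainder symbol is a symmetric operator. -/
theorem inner_remainder (hs : M.AssumptionAs) (hdiv : M.DivFree) {δ p x : ℝ} {χ : Sch}
    (hχ : χ ∈ M.hermiteSpan) {R : Hf} (hR : (schIncl χ, R) ∈ (M.remainder δ p x).graph)
    (ψ : M.xi.domain) {R' : Hf} (hR' : ((ψ : Hf), R') ∈ (M.remainder δ p x).graph) :
    inner ℂ R (ψ : Hf) = inner ℂ (schIncl χ) R' := by
  obtain ⟨φ, hφ⟩ := M.exists_isApprox ψ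
  obtain ⟨S, ρ, hS, hsum, hlim⟩ := (M.isApprox_const hχ).exists_mem_remainder_graph hs δ p x
  obtain ⟨S', ρ', hS', hsum', hlim'⟩ := hφ.exists_mem_remainder_graph hs δ p x
  obtain rfl : R = S := (M.remainder δ p x).mem_graph_snd_inj hR hS rfl
  obtain rfl : R' = S' := (M.remainder δ p x).mem_graph_snd_inj hR' hS' rfl
  have hρ : ∀ n, ρ n = M.remTerm δ p x n χ := fun n =>
    tendsto_nhds_unique (hlim n) tendsto_const_nhds
  -- Symmetry holds between opposite modes on Schwartz functions and passes to the limit; reindexing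
  -- the sum by `n ↦ -n` then yields it for the whole remainder.
  have hterm : ∀ n, inner ℂ (ρ n) (ψ : Hf) = inner ℂ (schIncl χ) (ρ' (-n)) := by
    intro n
    refine tendsto_nhds_unique (tendsto_const_nhds.inner hφ.tendsto)
      ((tendsto_const_nhds.inner (hlim' (-n))).congr fun k => ?_)
    rw [inner_remTerm hs hdiv, neg_neg, hρ]
  have h1 : HasSum (fun n => inner ℂ (schIncl χ) (ρ' n)) (inner ℂ (schIncl χ) R') :=
    (innerSL ℂ (schIncl χ)).hasSum hsum'
  have h2 : HasSum (fun n => inner ℂ (ψ : Hf) (ρ n)) (inner ℂ (ψ : Hf) R) :=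
    (innerSL ℂ (ψ : Hf)).hasSum hsum
  have h3 := h2.star
  have e : (fun n => star (inner ℂ (ψ : Hf) (ρ n)))
      = (fun n => inner ℂ (schIncl χ) (ρ' n)) ∘ Equiv.neg (ℤ × ℤ) := by
    funext n
    exact (inner_conj_symm _ _).trans (hterm n)
  rw [e, Equiv.hasSum_iff] at h3
  exact (inner_conj_symm _ _).symm.trans (h3.unique h1)

end BlochLandau

end

/-! ### The two estimates for the remainder -/

theorem proposition4p5 (M : BlochLandau) (hs : M.AssumptionAs) (hdiv : M.DivFree) :
    (∃ C : ℝ, ∀ δ : ℝ, 0 < δ → ∀ p x : ℝ,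
      M.NormFLe (M.remainder δ p x) (C * δ ^ (2 * (M.nat + 1)))) ∧
    ∀ s : Finset ℕ, ∃ C : ℝ, ∀ δ : ℝ, 0 < δ → ∀ p x : ℝ,
      ∃ S T : Hf →L[ℂ] Hf,
        M.IsRightComp (M.remainder δ p x) s S ∧
        M.IsLeftComp (M.remainder δ p x) s T ∧
        ‖S‖ = ‖T‖ ∧
        ‖S‖ ≤ C * δ ^ (2 * (M.nat + 1) + 1) ∧
        ‖S - T‖ ≤ C * δ ^ (2 * (M.nat + 1) + 1) := by
  have hpart := BlochLandau.exists_normFLe_remainder hs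
  refine ⟨hpart, fun s => ?_⟩
  have hmem : ∀ k, M.hermite k ∈ M.hermiteSpan := fun k => Submodule.subset_span ⟨k, rfl⟩
  choose C hC using fun k => BlochLandau.exists_remainder_hermiteSpan_le hs (hmem k)
  -- The factor `2` serves the commutator, bounded by `‖S‖ + ‖T‖ = 2‖S‖`.
  refine ⟨2 * ∑ k ∈ s, C k * ‖schIncl (M.hermite k)‖, fun δ hδ p x => ?_⟩
  choose R hR hRle using fun k => hC k δ hδ p x
  -- `Rπ = ∑ |Rψ_k⟩⟨ψ_k|`, and its adjoint `∑ |ψ_k⟩⟨Rψ_k|` agrees with `πR` on `F` by symmetry.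
  set S : Hf →L[ℂ] Hf :=
    ∑ k ∈ s, InnerProductSpace.rankOne ℂ (R k) (schIncl (M.hermite k)) with hS
  have hnorm : ‖ContinuousLinearMap.adjoint S‖ = ‖S‖ := LinearIsometryEquiv.norm_map _ _
  have hSle : ‖S‖ ≤ (∑ k ∈ s, C k * ‖schIncl (M.hermite k)‖) * δ ^ (2 * (M.nat + 1) + 1) := by
    rw [Finset.sum_mul]
    refine (norm_sum_le _ _).trans (Finset.sum_le_sum fun k _ => ?_)
    rw [InnerProductSpace.norm_rankOne, mul_right_comm]
    exact mul_le_mul_of_nonneg_right (hRle k) (norm_nonneg _)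
  refine ⟨S, ContinuousLinearMap.adjoint S, fun ψ => ?_, fun ψ => ?_, hnorm.symm, ?_, ?_⟩
  · have hg : (M.proj s ψ, S ψ) ∈ (M.remainder δ p x).graph := by
      have e : (M.proj s ψ, S ψ) = ∑ k ∈ s, inner ℂ (schIncl (M.hermite k)) ψ •
          (schIncl (M.hermite k), R k) := by
        rw [hS, BlochLandau.proj]
        simp [Prod.ext_iff, Prod.fst_sum, Prod.snd_sum]
      rw [e]
      exact Submodule.sum_mem _ fun k _ => Submodule.smul_mem _ _ (hR k)
    obtain ⟨h, e⟩ := mem_graph_iff_exists.1 hg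
    exact ⟨h, e.symm⟩
  · obtain ⟨C', hC'⟩ := hpart
    obtain ⟨h, -⟩ := hC' δ hδ p x ψ
    refine ⟨h, ?_⟩
    rw [hS, map_sum, BlochLandau.proj]
    simp only [InnerProductSpace.adjoint_rankOne, sum_apply,
      InnerProductSpace.rankOne_apply]
    refine Finset.sum_congr rfl fun k _ => ?_
    rw [BlochLandau.inner_remainder hs hdiv (hmem k) (hR k) ψ (mem_graph_iff_exists.2 ⟨h, rfl⟩)]
  · linarith [norm_nonneg S]
  · refine (norm_sub_le _ _).trans ?_
    rw [hnorm]
    linarith
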